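/- For each $N$ in a sequence of positive integers tending to infinity, let $M=M(N)$ be a divisor of $N$ with $M=o(N)$ (in particular $M$ may be fixed). Consider the stochastic block model on the vertex set $V=\{1,\dots,N\}$, partitioned into $M$ blocks of $N/M$ vertices each, with $B(v)\in\{1,\dots,M\}$ denoting the block of $v$. The random undirected graph has independent edges (loops $\{v,v\}$ are allowed and count once in the degree): $\{v,w\}$ is an edge with probability $p_m=p_m(N)\in[0,1]$ if $B(v)=B(w)=m$, and with probability $q=q(N)\in[0,1]$ if $B(v)\ne B(w)$. Put $$\gamma_m=\frac NM\,p_m+(M-1)\frac NM\,q ,$$ the expected degree of a vertex in block $m$, and let $\gamma_{\min},\gamma_{\max},p_{\min},p_{\max}$ be the minima and maxima of $\gamma_m$ and $p_m$ over $m$. Assume that, as $N\to\infty$, $\gamma_{\min}>0$ for all large $N$ and $$\max_{1\le m\le M}\ \frac{M\log^4 N}{Np_m+N(M-1)q}\cdot\frac{\gamma_{\max}^2}{\gamma_{\min}^2}\longrightarrow 0,$$ $$\Big(\frac{M\log N}{N}\Big)^{1/4}p_{\min}^{5/4}\,p_{\max}^{1/2}=o\big(((M-1)q)^2\big).$$ For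 a realization of the graph let $d_v$ be the degree of $v$, let $\pi_v=d_v/\sum_{w}d_w$ be the invariant distribution of simple random walk, let $H_{vw}\in[0,\infty]$ be the expected time at which the simple random walk started in $v$ first visits $w$ (so $H_{ww}=0$), and let $H_w=\sum_{v\in V}\pi_vH_{vw}$. Then asymptotically almost surely $$H_w=\frac NM\cdot\frac{\sum_{m=1}^M\gamma_m}{\gamma_{B(w)}}\,(1+o(1))\qquad\text{uniformly in } w\in V ,$$ that is, for every $\varepsilon>0$, the probability that for all $w\in V$ the quantity $H_w$ is finite and $$\Big|\frac{H_w}{\frac NM\sum_{m}\gamma_m/\gamma_{B(w)}}-1\Big|\le\varepsilon$$ tends to $1$ as $N\to\infty$. -/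

import Mathlib

open Filter Topology MeasureTheory ProbabilityTheory Asymptotics
open scoped ENNReal unitInterval

noncomputable section

namespace SBM

/-! ### Graphs with loops and the simple random walk -/

/-- An undirected graph on `{1, …, N}` in which loops are allowed: each unordered pair
(including the pairs `s(v, v)`) is declared to be an edge (`true`) or not (`false`). -/
abbrev LoopGraph (N : ℕ) : Type := Sym2 (Fin N) → Bool

variable {N M : ℕ}

/-- The set of neighbours of `v`; it contains `v` itself iff there is a loop at `v`. -/
def neighbors (G : LoopGraph N) (v : Fin N) : Finset (Fin N) :=
  Finset.univ.filter fun w => G s(v, w) = true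

/-- The degree `d_v = ∑_w a_{v,w}` (a loop counts once). -/
def degree (G : LoopGraph N) (v : Fin N) : ℕ := (neighbors G v).card

open scoped Classical in
/-- One step of simple random walk: a uniformly chosen neighbour of the current position. (At a
vertex of degree zero, where the walk is not defined, it is declared to stay put.) -/
def stepPMF (G : LoopGraph N) (v : Fin N) : PMF (Fin N) :=
  if h : (neighbors G v).Nonempty then PMF.uniformOfFinset (neighbors G v) h else PMF.pure v

/-- The transition kernel of simple random walk. -/
def stepKernel (G : LoopGraph N) : Kernel (Fin N) (Fin N) :=
  Kernel.ofFunOfCountable fun v => (stepPMF G v).toMeasure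

instance (G : LoopGraph N) : IsMarkovKernel (stepKernel G) :=
  ⟨fun v => by
    change IsProbabilityMeasure ((stepPMF G v).toMeasure)
    infer_instance⟩

/-- The law of `X_{t+1}` given `X_0, …, X_t`: it depends on `X_t` only. -/
def historyKernel (G : LoopGraph N) (t : ℕ) :
    Kernel (∀ _ : Finset.Iic t, Fin N) (Fin N) :=
  (stepKernel G).comap (fun x => x ⟨t, Finset.mem_Iic.2 le_rfl⟩) (measurable_pi_apply _)

instance (G : LoopGraph N) (t : ℕ) : IsMarkovKernel (historyKernel G t) := by
  unfold historyKernel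
  infer_instance

/-- The law, on the space of trajectories `ℕ → {1, …, N}`, of simple random walk started in `v`. -/
def walkLaw (G : LoopGraph N) (v : Fin N) : Measure (ℕ → Fin N) :=
  Kernel.trajMeasure (X := fun _ => Fin N) (Measure.dirac v) (historyKernel G)

/-- The first time `t ≥ 0` at which the trajectory `x` is in `w` (`∞` if there is none). -/
def hittingTime (w : Fin N) (x : ℕ → Fin N) : ℕ∞ :=
  hittingAfter (fun (t : ℕ) (y : ℕ → Fin N) => y t) {w} 0 x

/-- `H_{vw}`, the expected time that simple random walk started in `v` takes to reach `w`. -/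
def expectedHittingTime (G : LoopGraph N) (v w : Fin N) : ℝ≥0∞ :=
  ∫⁻ x, (hittingTime w x : ℝ≥0∞) ∂(walkLaw G v)

/-- The invariant distribution `π_v = d_v / ∑_w d_w`. -/
def stationary (G : LoopGraph N) (v : Fin N) : ℝ≥0∞ :=
  (degree G v : ℝ≥0∞) / ∑ w, (degree G w : ℝ≥0∞)

/-- `H_w = ∑_v π_v H_{vw}`. -/
def averageHittingTime (G : LoopGraph N) (w : Fin N) : ℝ≥0∞ :=
  ∑ v, stationary G v * expectedHittingTime G v w

/-! ### The stochastic block model -/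

/-- The data of a stochastic block model on `N` vertices with `M` blocks of equal size `N / M`:
the assignment of the vertices to the blocks, the edge probabilities `p_m` inside the blocks and
the edge probability `q` between different blocks. -/
structure BlockModel (N M : ℕ) where
  /-- `B(v)`, the block of the vertex `v`. -/
  block : Fin N → Fin M
  card_block : ∀ m, M * (Finset.univ.filter fun v => block v = m).card = N
  p : Fin M → I
  q : I

namespace BlockModel

variable (S : BlockModel N M)

/-- The probability of the edge `{v, w}`: `p_m` if both ends are in block `m`, and `q` if the ends
are in different blocks. -/
def edgeProb : Sym2 (Fin N) → I :=
  Sym2.lift ⟨fun v w => if S.block v = S.block w then S.p (S.block v) else S.q, by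
    intro v w
    by_cases h : S.block v = S.block w
    · simp [h]
    · simp [h, Ne.symm h]⟩

/-- The law of the random graph: all edges (and loops) are independent, and `e` is present with
probability `edgeProb e`. -/
def graphLaw : Measure (LoopGraph N) :=
  Measure.pi fun e => bernoulliMeasure true false (S.edgeProb e)

/-- `γ_m = (N/M) p_m + (M-1) (N/M) q`, the expected degree of a vertex in block `m`. -/
def γ (m : Fin M) : ℝ :=
  (N : ℝ) / M * (S.p m : ℝ) + ((M : ℝ) - 1) * ((N : ℝ) / M) * (S.q : ℝ)

def γmin : ℝ := ⨅ m, S.γ m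

def γmax : ℝ := ⨆ m, S.γ m

def pmin : ℝ := ⨅ m, (S.p m : ℝ)

def pmax : ℝ := ⨆ m, (S.p m : ℝ)

end BlockModel

/-- The connectivity condition
`M log⁴ N / (N p_m + N (M-1) q) * γ_max² / γ_min² → 0`, uniformly in the block `m`. The quotients
have to make sense, so `γ_min > 0` (for all large `k`) is part of the condition. -/
def ConnectivityCondition (N M : ℕ → ℕ) (S : ∀ k, BlockModel (N k) (M k)) : Prop :=
  (∀ᶠ k in atTop, 0 < (S k).γmin) ∧
  Tendsto (fun k => ⨆ m : Fin (M k),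
      (M k : ℝ) * Real.log (N k) ^ 4 /
          ((N k : ℝ) * ((S k).p m : ℝ) + (N k : ℝ) * ((M k : ℝ) - 1) * ((S k).q : ℝ)) *
        ((S k).γmax ^ 2 / (S k).γmin ^ 2))
    atTop (𝓝 0)

/-- The condition `((M-1) q)² ≫ (M log N / N)^{1/4} p_min^{5/4} p_max^{1/2}`. -/
def CrossBlockCondition (N M : ℕ → ℕ) (S : ∀ k, BlockModel (N k) (M k)) : Prop :=
  (fun k => ((M k : ℝ) * Real.log (N k) / (N k : ℝ)) ^ (1 / 4 : ℝ) *
      (S k).pmin ^ (5 / 4 : ℝ) * (S k).pmax ^ (1 / 2 : ℝ))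
    =o[atTop] fun k => (((M k : ℝ) - 1) * ((S k).q : ℝ)) ^ 2

end SBM

end

open Filter Topology MeasureTheory ProbabilityTheory Asymptotics
open scoped ENNReal unitInterval

noncomputable section
namespace SBM
variable {N M : ℕ}

/-! ### Expected hitting times as solutions of a linear system -/

/-! Write `y = crossDegree` for the mean number of neighbours in other blocks. On a graph whose
degrees are close to their means and which has a Poincaré inequality with constant of order `y`,
`H_w` is asymptotically `1 / π_w`, and `π_w = d_w / ∑ d_v` is close to `γ_{B(w)} / ((N/M) ∑ γ_m)`.

Deterministic part. By first-step analysis, `φ = π_w (H_w - H_{·w})` has `π`-mean zero and solves `φ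
- Pφ = 1_w - π_w`, with `φ(w) = π_w H_w`. A direct energy estimate of `φ(w)` only gives a bound of
order `Δ/c`. One step of smoothing improves it: for `ψ = Pφ`, the Dirichlet energy equals `∑_v
a_{wv} ψ(v) = d_w (Pψ)(w)`, so Cauchy–Schwarz over the `d_w` neighbours of `w` together with the
Poincaré inequality bounds `(Pψ)(w)` by `Δ/(cδ)`. Since `π_w H_w - 1` differs from `(Pψ)(w)` only by
a loop term and `-2π_w`, this gives `abs_averageHittingTime_sub_one_le`.

Probabilistic part. Edges between blocks alone make the graph expand: a set of at most half of the
vertices has mean cross-block boundary at least `y/2` times its size. Chernoff bounds and a union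
bound over all sets (`measure_not_isTypical_le`) keep half of this, and Cheeger's inequality
(`poincare_of_isoperimetric`) turns it into a Poincaré constant `y/64`, which passes to the full
graph by monotonicity of the energy.

Parameters. The errors are of order `γmax / (y γmin)`, and the union bounds need `y` to exceed a
large multiple of `log N`. Both follow from the assumptions (`cross_large`), by cases according to
whether `(N/M) p_min` or `y` dominates in `γmin`. -/

lemma lintegral_walkLaw_zero (G : LoopGraph N) (v : Fin N) (f : Fin N → ℝ≥0∞) :
    ∫⁻ x, f (x 0) ∂(walkLaw G v) = f v := by
  have hmap : (walkLaw G v).map (Preorder.frestrictLe (π := fun _ => Fin N) 0) =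
      (Measure.dirac v).map
        (MeasurableEquiv.piUnique (fun _ : Finset.Iic 0 => Fin N)).symm := by
    rw [walkLaw, Kernel.trajMeasure, Measure.map_comp _ _ (by fun_prop),
      Kernel.traj_map_frestrictLe, Kernel.partialTraj_self]
    exact Measure.id_comp
  have h := lintegral_map (μ := walkLaw G v)
    (f := fun y : (∀ _ : Finset.Iic 0, Fin N) => f (y ⟨0, Finset.mem_Iic.2 le_rfl⟩))
    (g := Preorder.frestrictLe (π := fun _ => Fin N) 0)
    ((measurable_of_countable f).comp (measurable_pi_apply _)) (by fun_prop)
  rw [hmap, lintegral_map (measurable_of_countable _) (by fun_prop),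
    lintegral_dirac' _ (measurable_of_countable _)] at h
  exact h.symm

lemma lintegral_stepKernel (G : LoopGraph N) (v : Fin N) (f : Fin N → ℝ≥0∞) :
    ∫⁻ u, f u ∂(stepKernel G v) = ∑ u, stepPMF G v u * f u := by
  have : stepKernel G v = (stepPMF G v).toMeasure := rfl
  rw [this, lintegral_fintype]
  refine Finset.sum_congr rfl fun u _ => ?_
  rw [PMF.toMeasure_apply_singleton _ _ (measurableSet_singleton u), mul_comm]

/-- The Markov property, read off from the disintegration of the trajectory law at time `t`. -/
lemma lintegral_walkLaw_succ (G : LoopGraph N) (v : Fin N) (t : ℕ)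
    (F : (∀ _ : Finset.Iic t, Fin N) → ℝ≥0∞) (f : Fin N → ℝ≥0∞) :
    ∫⁻ x, F (Preorder.frestrictLe (π := fun _ => Fin N) t x) * f (x (t + 1)) ∂(walkLaw G v) =
      ∫⁻ x, F (Preorder.frestrictLe (π := fun _ => Fin N) t x) *
        ∑ u, stepPMF G (x t) u * f u ∂(walkLaw G v) := by
  have key := Kernel.map_frestrictLe_trajMeasure_compProd_eq_map_trajMeasure
    (X := fun _ => Fin N) (μ₀ := Measure.dirac v) (κ := historyKernel G) (a := t)
  have hmeas : Measurable (fun z : (∀ _ : Finset.Iic t, Fin N) × Fin N => F z.1 * f z.2) :=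
    measurable_of_countable _
  have h := lintegral_map (μ := walkLaw G v) hmeas
    (g := fun x => (Preorder.frestrictLe (π := fun _ => Fin N) t x, x (t + 1))) (by fun_prop)
  rw [walkLaw] at h ⊢
  rw [← h, ← key, Measure.lintegral_compProd hmeas,
    lintegral_map (measurable_of_countable _) (by fun_prop)]
  refine lintegral_congr fun x => ?_
  change ∫⁻ b, F (Preorder.frestrictLe (π := fun _ => Fin N) t x) * f b ∂(stepKernel G (x t)) = _
  rw [lintegral_const_mul _ (measurable_of_countable f)]
  congr 1
  exact lintegral_stepKernel G (x t) f

/-- The transition operator of simple random walk killed at `w`. -/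
def killedStep (G : LoopGraph N) (w : Fin N) (f : Fin N → ℝ≥0∞) (v : Fin N) : ℝ≥0∞ :=
  ∑ u, stepPMF G v u * if u = w then 0 else f u

/-- The product is the indicator that `w` is avoided up to and including time `t`. `killedStep`
kills on arrival, so the start at `w` needs its own case. -/
lemma lintegral_walkLaw_killed (G : LoopGraph N) (v w : Fin N) (t : ℕ) (f : Fin N → ℝ≥0∞) :
    ∫⁻ x, (∏ i ∈ Finset.range (t + 1), if x i = w then 0 else 1) * f (x t) ∂(walkLaw G v) =
      if v = w then 0 else (killedStep G w)^[t] f v := by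
  induction t generalizing f with
  | zero =>
    have h := lintegral_walkLaw_zero G v (fun u => (if u = w then 0 else 1) * f u)
    simp only [zero_add, Finset.prod_range_one, Function.iterate_zero, id]
    rw [h]
    split_ifs <;> simp
  | succ t ih =>
    rw [Function.iterate_succ_apply, ← ih (killedStep G w f)]
    have h := lintegral_walkLaw_succ G v t
      (fun y => ∏ i : Finset.Iic t, if y i = w then 0 else 1) (fun u => if u = w then 0 else f u)
    have hprod : ∀ x : ℕ → Fin N,
        (∏ i : Finset.Iic t, if Preorder.frestrictLe (π := fun _ => Fin N) t x i = w
          then (0 : ℝ≥0∞) else 1) = ∏ i ∈ Finset.range (t + 1), if x i = w then 0 else 1 := by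
      intro x
      have : Finset.range (t + 1) = Finset.Iic t := by ext; simp
      rw [this, ← Finset.prod_coe_sort (Finset.Iic t)]
      rfl
    simp only [hprod] at h
    unfold killedStep
    rw [← h]
    refine lintegral_congr fun x => ?_
    rw [Finset.prod_range_succ _ (t + 1), mul_assoc]
    split_ifs <;> simp

lemma ENat.toENNReal_eq_tsum (n : ℕ∞) :
    (n : ℝ≥0∞) = ∑' t : ℕ, if (t : ℕ∞) < n then 1 else 0 := by
  induction n using ENat.recTopCoe with
  | top => simp
  | coe n =>
    rw [tsum_eq_sum (s := Finset.range n) (by simp)]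
    have : ∀ t ∈ Finset.range n, (if (t : ℕ∞) < n then (1 : ℝ≥0∞) else 0) = 1 := by
      intro t ht
      simpa using ht
    rw [Finset.sum_congr rfl this]
    simp

lemma lt_hittingTime_iff (w : Fin N) (x : ℕ → Fin N) (t : ℕ) :
    (t : ℕ∞) < hittingTime w x ↔ ∀ i ∈ Finset.range (t + 1), x i ≠ w := by
  have h := hittingAfter_le_iff (u := fun (t : ℕ) (y : ℕ → Fin N) => y t) (s := {w}) (n := 0)
    (i := t) (ω := x)
  rw [← not_iff_not]
  push Not
  refine h.trans ?_
  simp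

/-- The tail-sum formula for an expectation, with the tails given by the killed walk. -/
lemma expectedHittingTime_eq_tsum (G : LoopGraph N) (v w : Fin N) :
    expectedHittingTime G v w =
      ∑' t : ℕ, if v = w then 0 else (killedStep G w)^[t] 1 v := by
  have h : ∀ x : ℕ → Fin N, (hittingTime w x : ℝ≥0∞) =
      ∑' t : ℕ, (∏ i ∈ Finset.range (t + 1), if x i = w then (0 : ℝ≥0∞) else 1) *
        (1 : Fin N → ℝ≥0∞) (x t) := by
    intro x
    rw [ENat.toENNReal_eq_tsum]
    refine tsum_congr fun t => ?_
    simp only [lt_hittingTime_iff, Pi.one_apply, mul_one]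
    split_ifs with hx
    · exact (Finset.prod_eq_one fun i hi => by simp [hx i hi]).symm
    · push Not at hx
      obtain ⟨i, hi, hxi⟩ := hx
      exact (Finset.prod_eq_zero hi (by simp [hxi])).symm
  unfold expectedHittingTime
  simp only [h]
  rw [lintegral_tsum]
  · exact tsum_congr fun t => lintegral_walkLaw_killed G v w t 1
  · intro t
    refine Measurable.aemeasurable ?_
    refine Measurable.mul ?_ ((measurable_of_countable _).comp (measurable_pi_apply t))
    refine Finset.measurable_prod _ fun i _ => ?_
    exact (measurable_of_countable (fun u : Fin N => if u = w then (0 : ℝ≥0∞) else 1)).comp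
      (measurable_pi_apply i)

lemma expectedHittingTime_self (G : LoopGraph N) (w : Fin N) :
    expectedHittingTime G w w = 0 := by
  simp [expectedHittingTime_eq_tsum]

lemma expectedHittingTime_step (G : LoopGraph N) {v w : Fin N} (hvw : v ≠ w) :
    expectedHittingTime G v w = 1 + ∑ u, stepPMF G v u * expectedHittingTime G u w := by
  simp only [expectedHittingTime_eq_tsum, if_neg hvw]
  rw [tsum_eq_zero_add' ENNReal.summable]
  congr 1
  simp only [Function.iterate_succ_apply', killedStep, ← ENNReal.tsum_mul_left]
  rw [Summable.tsum_finsetSum (fun _ _ => ENNReal.summable)]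

/-- Minimality among nonnegative supersolutions: every partial tail sum stays below `g`, by
induction on its length. Finiteness of the hitting times comes from a finite `g`. -/
lemma expectedHittingTime_le (G : LoopGraph N) (w : Fin N) (g : Fin N → ℝ≥0∞)
    (hg : ∀ v, v ≠ w → 1 + ∑ u, stepPMF G v u * g u ≤ g v) (v : Fin N) :
    expectedHittingTime G v w ≤ g v := by
  rw [expectedHittingTime_eq_tsum]
  refine ENNReal.tsum_le_of_sum_range_le fun T => ?_
  induction T generalizing v with
  | zero => simp
  | succ T ih =>
    by_cases hvw : v = w
    · simp [hvw]
    refine le_trans ?_ (hg v hvw)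
    rw [Finset.sum_range_succ', add_comm]
    simp only [if_neg hvw, Function.iterate_succ_apply', Function.iterate_zero, id, Pi.one_apply,
      killedStep]
    gcongr
    rw [Finset.sum_comm]
    refine Finset.sum_le_sum fun u _ => ?_
    rw [← Finset.mul_sum]
    gcongr
    exact ih u

lemma stepPMF_apply (G : LoopGraph N) {v : Fin N} (hv : 0 < degree G v) (u : Fin N) :
    stepPMF G v u = if u ∈ neighbors G v then (degree G v : ℝ≥0∞)⁻¹ else 0 := by
  classical
  have h : (neighbors G v).Nonempty := Finset.card_pos.1 hv
  rw [stepPMF, dif_pos h, PMF.uniformOfFinset_apply]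
  unfold degree
  congr

/-! ### Hitting times and the Dirichlet form -/

/-- The entries of the adjacency matrix. -/
def adj (G : LoopGraph N) (v w : Fin N) : ℝ := if G s(v, w) = true then 1 else 0

lemma adj_comm (G : LoopGraph N) (v w : Fin N) : adj G v w = adj G w v := by
  unfold adj
  rw [Sym2.eq_swap]

lemma adj_nonneg (G : LoopGraph N) (v w : Fin N) : 0 ≤ adj G v w := by
  unfold adj
  split_ifs <;> simp

lemma adj_le_one (G : LoopGraph N) (v w : Fin N) : adj G v w ≤ 1 := by
  unfold adj
  split_ifs <;> simp

lemma adj_sq (G : LoopGraph N) (v w : Fin N) : adj G v w ^ 2 = adj G v w := by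
  unfold adj
  split_ifs <;> simp

lemma sum_adj (G : LoopGraph N) (v : Fin N) : ∑ w, adj G v w = degree G v := by
  simp [adj, degree, neighbors]

/-- The Dirichlet form of the symmetric weights `a`. -/
def dirichlet (a : Fin N → Fin N → ℝ) (f : Fin N → ℝ) : ℝ :=
  (∑ v, ∑ w, a v w * (f v - f w) ^ 2) / 2

/-- The transition operator of simple random walk, on real functions. -/
def stepOp (G : LoopGraph N) (f : Fin N → ℝ) (v : Fin N) : ℝ :=
  (∑ w, adj G v w * f w) / degree G v

lemma degree_mul_stepOp (G : LoopGraph N) {v : Fin N} (hv : 0 < degree G v) (f : Fin N → ℝ) :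
    degree G v * stepOp G f v = ∑ w, adj G v w * f w := by
  have : (degree G v : ℝ) ≠ 0 := by exact_mod_cast hv.ne'
  unfold stepOp
  field_simp

lemma stepOp_const (G : LoopGraph N) {v : Fin N} (hv : 0 < degree G v) (c : ℝ) :
    stepOp G (fun _ => c) v = c := by
  have : (degree G v : ℝ) ≠ 0 := by exact_mod_cast hv.ne'
  unfold stepOp
  rw [← Finset.sum_mul, sum_adj]
  field_simp

lemma stepOp_add (G : LoopGraph N) (f g : Fin N → ℝ) (v : Fin N) :
    stepOp G (fun u => f u + g u) v = stepOp G f v + stepOp G g v := by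
  simp only [stepOp, mul_add, Finset.sum_add_distrib, add_div]

lemma stepOp_smul (G : LoopGraph N) (c : ℝ) (f : Fin N → ℝ) (v : Fin N) :
    stepOp G (fun u => c * f u) v = c * stepOp G f v := by
  simp only [stepOp, mul_left_comm _ c, ← Finset.mul_sum, mul_div_assoc]

lemma stepOp_single (G : LoopGraph N) (v w : Fin N) :
    stepOp G (fun u => if u = w then 1 else 0) v = adj G v w / degree G v := by
  simp [stepOp]

lemma dirichlet_eq (G : LoopGraph N) (hpos : ∀ v, 0 < degree G v) (f : Fin N → ℝ) :
    dirichlet (adj G) f = ∑ v, degree G v * (f v * (f v - stepOp G f v)) := by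
  have h1 : ∀ v, (degree G v : ℝ) * (f v * (f v - stepOp G f v)) =
      ∑ w, adj G v w * (f v * f v - f v * f w) := by
    intro v
    calc (degree G v : ℝ) * (f v * (f v - stepOp G f v))
        = degree G v * (f v * f v) - f v * (degree G v * stepOp G f v) := by ring
      _ = _ := by
        rw [degree_mul_stepOp G (hpos v), ← sum_adj, Finset.sum_mul, Finset.mul_sum,
          ← Finset.sum_sub_distrib]
        exact Finset.sum_congr rfl fun w _ => by ring
  have h2 : ∑ v, ∑ w, adj G v w * (f v * f v - f v * f w) =
      ∑ v, ∑ w, adj G v w * (f w * f w - f w * f v) := by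
    rw [Finset.sum_comm]
    exact Finset.sum_congr rfl fun v _ => Finset.sum_congr rfl fun w _ => by rw [adj_comm]
  rw [Finset.sum_congr rfl fun v _ => h1 v, dirichlet]
  have h3 : ∑ v, ∑ w, adj G v w * (f v - f w) ^ 2 =
      ∑ v, ∑ w, adj G v w * (f v * f v - f v * f w) +
        ∑ v, ∑ w, adj G v w * (f w * f w - f w * f v) := by
    rw [← Finset.sum_add_distrib]
    refine Finset.sum_congr rfl fun v _ => ?_
    rw [← Finset.sum_add_distrib]
    exact Finset.sum_congr rfl fun w _ => by ring
  rw [h3, ← h2]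
  ring

lemma sum_degree_mul_stepOp (G : LoopGraph N) (hpos : ∀ v, 0 < degree G v) (f : Fin N → ℝ) :
    ∑ v, degree G v * stepOp G f v = ∑ v, degree G v * f v := by
  simp only [fun v => degree_mul_stepOp G (hpos v) f]
  rw [Finset.sum_comm]
  refine Finset.sum_congr rfl fun v _ => ?_
  rw [← sum_adj, Finset.sum_mul]
  exact Finset.sum_congr rfl fun w _ => by rw [adj_comm]

/-- A Poincaré inequality with constant `c` for the Dirichlet form of `a`, with respect to
counting measure. -/
def Poincare (a : Fin N → Fin N → ℝ) (c : ℝ) : Prop :=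
  ∀ f : Fin N → ℝ, ∃ m : ℝ, c * ∑ v, (f v - m) ^ 2 ≤ dirichlet a f

lemma eq_const_of_dirichlet_eq_zero {a : Fin N → Fin N → ℝ} {c : ℝ} (hc : 0 < c)
    (hP : Poincare a c) {f : Fin N → ℝ} (hf : dirichlet a f = 0) (v w : Fin N) : f v = f w := by
  obtain ⟨m, hm⟩ := hP f
  rw [hf] at hm
  have h0 : ∑ v, (f v - m) ^ 2 = 0 :=
    le_antisymm (nonpos_of_mul_nonpos_right hm hc) (Finset.sum_nonneg fun v _ => sq_nonneg _)
  have h1 : ∀ v, f v = m := fun v => by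
    have := (Finset.sum_eq_zero_iff_of_nonneg (fun v _ => sq_nonneg (f v - m))).1 h0 v
      (Finset.mem_univ v)
    have := pow_eq_zero_iff (two_ne_zero) |>.1 this
    linarith
  rw [h1, h1]

/-- Solvability of the system for the expected hitting times of `w`. -/
lemma exists_hitting_solution (G : LoopGraph N) (hpos : ∀ v, 0 < degree G v) {c : ℝ} (hc : 0 < c)
    (hP : Poincare (adj G) c) (w : Fin N) :
    ∃ g : Fin N → ℝ, (∀ v, 0 ≤ g v) ∧ g w = 0 ∧ ∀ v, v ≠ w → g v = 1 + stepOp G g v := by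
  let T : (Fin N → ℝ) →ₗ[ℝ] (Fin N → ℝ) :=
    { toFun := fun g v => if v = w then g w else g v - stepOp G g v
      map_add' := by
        intro f g
        ext v
        have := stepOp_add G f g v
        simp only [Pi.add_apply] at this ⊢
        change (if v = w then f w + g w else f v + g v - stepOp G (fun u => f u + g u) v) = _
        rw [this]
        split_ifs <;> ring
      map_smul' := by
        intro a f
        ext v
        have := stepOp_smul G a f v
        change (if v = w then a * f w else a * f v - stepOp G (fun u => a * f u) v) =
          a * (if v = w then f w else f v - stepOp G f v)
        rw [this]
        split_ifs <;> ring }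
  -- A kernel element vanishes at `w` and is harmonic elsewhere, so its energy is zero and it is
  -- constant, hence zero. Finite dimension then gives surjectivity.
  have hinj : Function.Injective T := by
    rw [← LinearMap.ker_eq_bot, LinearMap.ker_eq_bot']
    intro g hg
    have hg' : ∀ v, (if v = w then g w else g v - stepOp G g v) = 0 := fun v => congrFun hg v
    have hw : g w = 0 := by simpa using hg' w
    have h0 : dirichlet (adj G) g = 0 := by
      rw [dirichlet_eq G hpos]
      refine Finset.sum_eq_zero fun v _ => ?_
      by_cases h : v = w
      · subst h
        simp [hw]
      · have := hg' v
        rw [if_neg h] at this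
        simp [this]
    ext v
    rw [eq_const_of_dirichlet_eq_zero hc hP h0 v w, hw, Pi.zero_apply]
  obtain ⟨g, hg⟩ := (LinearMap.injective_iff_surjective.1 hinj) (fun v => if v = w then 0 else 1)
  have hg' : ∀ v, (if v = w then g w else g v - stepOp G g v) = if v = w then 0 else 1 :=
    fun v => congrFun hg v
  have hw : g w = 0 := by simpa using hg' w
  have hstep : ∀ v, v ≠ w → g v = 1 + stepOp G g v := by
    intro v hv
    have := hg' v
    simp only [if_neg hv] at this
    linarith
  refine ⟨g, ?_, hw, hstep⟩
  -- Minimum principle: away from `w`, a minimum would exceed the average of its neighbours by one.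
  obtain ⟨v₀, -, hmin⟩ := Finset.exists_min_image Finset.univ g ⟨w, Finset.mem_univ w⟩
  have hge : 0 ≤ g v₀ := by
    by_cases h : v₀ = w
    · rw [h, hw]
    · have h1 := hstep v₀ h
      have h2 : g v₀ ≤ stepOp G g v₀ := by
        have hd : (0 : ℝ) < degree G v₀ := by exact_mod_cast hpos v₀
        rw [stepOp, le_div_iff₀ hd, ← sum_adj, Finset.mul_sum]
        refine Finset.sum_le_sum fun u _ => ?_
        rw [mul_comm]
        exact mul_le_mul_of_nonneg_left (hmin u (Finset.mem_univ u)) (adj_nonneg G _ _)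
      linarith
  exact fun v => hge.trans (hmin v (Finset.mem_univ v))

lemma toReal_sum_stepPMF (G : LoopGraph N) {v : Fin N} (hv : 0 < degree G v) (g : Fin N → ℝ≥0∞)
    (hg : ∀ u, g u ≠ ∞) :
    (∑ u, stepPMF G v u * g u).toReal = stepOp G (fun u => (g u).toReal) v := by
  have hne : ∀ u ∈ Finset.univ, stepPMF G v u * g u ≠ ∞ := fun u _ =>
    ENNReal.mul_ne_top (PMF.apply_ne_top _ _) (hg u)
  rw [ENNReal.toReal_sum hne, stepOp, Finset.sum_div]
  refine Finset.sum_congr rfl fun u _ => ?_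
  rw [ENNReal.toReal_mul, stepPMF_apply G hv]
  simp only [adj, neighbors, Finset.mem_filter, Finset.mem_univ, true_and]
  split_ifs
  · rw [ENNReal.toReal_inv, ENNReal.toReal_natCast]
    ring
  · simp

lemma expectedHittingTime_ne_top (G : LoopGraph N) (hpos : ∀ v, 0 < degree G v) {c : ℝ}
    (hc : 0 < c) (hP : Poincare (adj G) c) (v w : Fin N) :
    expectedHittingTime G v w ≠ ∞ := by
  obtain ⟨g, hg0, -, hg⟩ := exists_hitting_solution G hpos hc hP w
  refine ne_top_of_le_ne_top (ENNReal.ofReal_ne_top (r := g v))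
    (expectedHittingTime_le G w (fun u => ENNReal.ofReal (g u)) (fun u hu => ?_) v)
  have h := toReal_sum_stepPMF G (hpos u) (fun u => ENNReal.ofReal (g u))
    (fun _ => ENNReal.ofReal_ne_top)
  simp only [ENNReal.toReal_ofReal (hg0 _)] at h
  have hne : ∑ x, stepPMF G u x * ENNReal.ofReal (g x) ≠ ∞ :=
    ENNReal.sum_ne_top.2 fun x _ =>
      ENNReal.mul_ne_top (PMF.apply_ne_top _ _) ENNReal.ofReal_ne_top
  refine le_of_eq ?_
  rw [hg u hu, ← h, ENNReal.ofReal_add zero_le_one ENNReal.toReal_nonneg, ENNReal.ofReal_one,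
    ENNReal.ofReal_toReal hne]

lemma averageHittingTime_ne_top (G : LoopGraph N) (hpos : ∀ v, 0 < degree G v) {c : ℝ}
    (hc : 0 < c) (hP : Poincare (adj G) c) (w : Fin N) : averageHittingTime G w ≠ ∞ := by
  refine ENNReal.sum_ne_top.2 fun v _ =>
    ENNReal.mul_ne_top (ENNReal.div_ne_top (ENNReal.natCast_ne_top _) ?_)
      (expectedHittingTime_ne_top G hpos hc hP v w)
  intro h
  have := (Finset.sum_eq_zero_iff.1 h) w (Finset.mem_univ w)
  exact (hpos w).ne' (by exact_mod_cast this)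

lemma toReal_averageHittingTime (G : LoopGraph N) (hpos : ∀ v, 0 < degree G v) {c : ℝ}
    (hc : 0 < c) (hP : Poincare (adj G) c) (w : Fin N) :
    (averageHittingTime G w).toReal =
      (∑ v, degree G v * (expectedHittingTime G v w).toReal) / ∑ v, (degree G v : ℝ) := by
  have h0 : (∑ v, (degree G v : ℝ≥0∞)) ≠ 0 := by
    intro h
    have := (Finset.sum_eq_zero_iff.1 h) w (Finset.mem_univ w)
    exact (hpos w).ne' (by exact_mod_cast this)
  rw [averageHittingTime, ENNReal.toReal_sum, Finset.sum_div]
  · refine Finset.sum_congr rfl fun v _ => ?_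
    rw [ENNReal.toReal_mul, stationary, ENNReal.toReal_div, ENNReal.toReal_sum]
    · simp only [ENNReal.toReal_natCast]
      ring
    · exact fun _ _ => ENNReal.natCast_ne_top _
  · exact fun v _ => ENNReal.mul_ne_top (ENNReal.div_ne_top (ENNReal.natCast_ne_top _) h0)
      (expectedHittingTime_ne_top G hpos hc hP v w)

/-- The weighted mean minimises the weighted variance, so a function of mean zero may be centred at
the constant supplied by `Poincare`. -/
lemma sum_degree_mul_sq_le (G : LoopGraph N) {c Δ : ℝ} (hc : 0 < c) (hP : Poincare (adj G) c)
    (hΔ : ∀ v, (degree G v : ℝ) ≤ Δ) {f : Fin N → ℝ} (hf : ∑ v, degree G v * f v = 0) :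
    ∑ v, degree G v * f v ^ 2 ≤ Δ / c * dirichlet (adj G) f := by
  obtain ⟨m, hm⟩ := hP f
  have h1 : ∑ v, (degree G v : ℝ) * f v ^ 2 ≤ ∑ v, degree G v * (f v - m) ^ 2 := by
    have : ∑ v, (degree G v : ℝ) * (f v - m) ^ 2 =
        ∑ v, degree G v * f v ^ 2 - 2 * m * ∑ v, degree G v * f v + ∑ v, degree G v * m ^ 2 := by
      rw [Finset.mul_sum, ← Finset.sum_sub_distrib, ← Finset.sum_add_distrib]
      exact Finset.sum_congr rfl fun v _ => by ring
    rw [this, hf]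
    have : 0 ≤ ∑ v, (degree G v : ℝ) * m ^ 2 := Finset.sum_nonneg fun v _ => by positivity
    linarith
  have h2 : ∑ v, (degree G v : ℝ) * (f v - m) ^ 2 ≤ Δ * ∑ v, (f v - m) ^ 2 := by
    rw [Finset.mul_sum]
    exact Finset.sum_le_sum fun v _ => mul_le_mul_of_nonneg_right (hΔ v) (sq_nonneg _)
  have h3 : Δ * ∑ v, (f v - m) ^ 2 ≤ Δ / c * dirichlet (adj G) f := by
    rcases N.eq_zero_or_pos with rfl | hN
    · simp [dirichlet]
    have hΔ0 : 0 ≤ Δ := (Nat.cast_nonneg _).trans (hΔ ⟨0, hN⟩)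
    have : Δ * ∑ v, (f v - m) ^ 2 = Δ / c * (c * ∑ v, (f v - m) ^ 2) := by
      field_simp
    rw [this]
    exact mul_le_mul_of_nonneg_left hm (by positivity)
  linarith

/-- If the degrees lie between `δ` and `Δ` and the Dirichlet form satisfies a Poincaré inequality
with constant `c`, then `π_w H_w = 1 + O(π_w + 1/δ + Δ/(cδ))`. -/
theorem abs_averageHittingTime_sub_one_le (G : LoopGraph N) {c δ Δ : ℝ} (hc : 0 < c) (hδ : 0 < δ)
    (hP : Poincare (adj G) c) (hδd : ∀ v, δ ≤ (degree G v : ℝ))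
    (hΔ : ∀ v, (degree G v : ℝ) ≤ Δ) (w : Fin N) :
    |(averageHittingTime G w).toReal * (degree G w / ∑ v, (degree G v : ℝ)) - 1| ≤
      2 * (degree G w / ∑ v, (degree G v : ℝ)) + 1 / δ + Δ / (c * δ) := by
  have hposR : ∀ v, (0 : ℝ) < degree G v := fun v => hδ.trans_le (hδd v)
  have hpos : ∀ v, 0 < degree G v := fun v => by exact_mod_cast hposR v
  rw [toReal_averageHittingTime G hpos hc hP w]
  set h : Fin N → ℝ := fun v => (expectedHittingTime G v w).toReal with hh
  have hstep : ∀ v, v ≠ w → h v = 1 + stepOp G h v := by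
    intro v hv
    have hne : ∑ u, stepPMF G v u * expectedHittingTime G u w ≠ ∞ :=
      ENNReal.sum_ne_top.2 fun u _ => ENNReal.mul_ne_top (PMF.apply_ne_top _ _)
        (expectedHittingTime_ne_top G hpos hc hP u w)
    have := congrArg ENNReal.toReal (expectedHittingTime_step G hv)
    rw [ENNReal.toReal_add ENNReal.one_ne_top hne, toReal_sum_stepPMF G (hpos v) _
      (fun u => expectedHittingTime_ne_top G hpos hc hP u w)] at this
    simpa using this
  have hw : h w = 0 := by simp [hh, expectedHittingTime_self]
  set D : ℝ := ∑ v, (degree G v : ℝ) with hD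
  have hD0 : 0 < D := Finset.sum_pos (fun v _ => hposR v) ⟨w, Finset.mem_univ w⟩
  set H : ℝ := (∑ v, degree G v * h v) / D with hH
  set p : ℝ := degree G w / D with hp
  have hp0 : 0 ≤ p := by positivity
  -- The solution of the Poisson equation `φ - Pφ = 1_w - π_w` with mean zero.
  set φ : Fin N → ℝ := fun v => p * H + -p * h v with hφ
  have hφP : ∀ v, stepOp G φ v = p * H + -p * stepOp G h v := by
    intro v
    have := stepOp_add G (fun _ => p * H) (fun v => -p * h v) v
    rw [stepOp_const G (hpos v), stepOp_smul] at this
    exact this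
  have hφ0 : ∑ v, degree G v * φ v = 0 := by
    have : ∑ v, (degree G v : ℝ) * φ v = p * H * D - p * ∑ v, degree G v * h v := by
      rw [hD, Finset.mul_sum, Finset.mul_sum, ← Finset.sum_sub_distrib]
      exact Finset.sum_congr rfl fun v _ => by simp only [hφ]; ring
    rw [this, hH]
    field_simp
    ring
  have hφne : ∀ v, v ≠ w → φ v - stepOp G φ v = -p := by
    intro v hv
    rw [hφP]
    simp only [hφ]
    rw [hstep v hv]
    ring
  -- The value at `w` is forced, because `φ - Pφ` has degree-weighted sum zero.
  have hφw : φ w - stepOp G φ w = 1 - p := by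
    have h1 : ∑ v, degree G v * (φ v - stepOp G φ v) = 0 := by
      simp only [mul_sub, Finset.sum_sub_distrib, sum_degree_mul_stepOp G hpos, sub_self]
    have h2 : ∑ v, (degree G v : ℝ) * (φ v - stepOp G φ v + p) =
        degree G w * (φ w - stepOp G φ w + p) := by
      refine Finset.sum_eq_single w (fun v _ hv => ?_) (by simp)
      rw [hφne v hv]
      ring
    simp only [mul_add, Finset.sum_add_distrib, h1, ← Finset.sum_mul, ← hD] at h2
    have h3 : D * p = degree G w := by
      rw [hp]
      field_simp
    have h4 : (degree G w : ℝ) * (φ w - stepOp G φ w + p - 1) = 0 := by linarith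
    have := (mul_eq_zero.1 h4).resolve_left (hposR w).ne'
    linarith
  set ψ : Fin N → ℝ := fun v => φ v + (p + -1 * if v = w then 1 else 0) with hψ
  have hψφ : ∀ v, ψ v = stepOp G φ v := by
    intro v
    by_cases hv : v = w
    · subst hv
      simp only [hψ, if_true]
      linarith
    · have := hφne v hv
      simp only [hψ, if_neg hv]
      linarith
  have hψ0 : ∑ v, degree G v * ψ v = 0 := by
    simp only [hψφ, sum_degree_mul_stepOp G hpos, hφ0]
  have hψP : ∀ v, stepOp G ψ v = stepOp G φ v + (p - adj G v w / degree G v) := by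
    intro v
    have h1 := stepOp_add G φ (fun v => p + -1 * if v = w then 1 else 0) v
    have h2 := stepOp_add G (fun _ => p) (fun v => -1 * if v = w then 1 else 0) v
    rw [stepOp_const G (hpos v), stepOp_smul, stepOp_single] at h2
    rw [h2] at h1
    rw [show stepOp G ψ v = _ from h1]
    ring
  -- Here `ψ - Pψ = P(1_w - p)`, which at `v` is `a_{vw}/d_v - p`. The constant drops out against
  -- the mean-zero `ψ`.
  have hE : dirichlet (adj G) ψ = ∑ v, adj G w v * ψ v := by
    rw [dirichlet_eq G hpos]
    have : ∀ v, (degree G v : ℝ) * (ψ v * (ψ v - stepOp G ψ v)) =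
        adj G w v * ψ v - p * (degree G v * ψ v) := by
      intro v
      have hd := (hposR v).ne'
      rw [hψP, ← hψφ, adj_comm G w v]
      field_simp
      ring
    rw [Finset.sum_congr rfl fun v _ => this v, Finset.sum_sub_distrib, ← Finset.mul_sum, hψ0]
    ring
  have hη : stepOp G ψ w = dirichlet (adj G) ψ / degree G w := by
    rw [hE]
    rfl
  have hE0 : 0 ≤ dirichlet (adj G) ψ := by
    unfold dirichlet
    have : 0 ≤ ∑ v, ∑ u, adj G v u * (ψ v - ψ u) ^ 2 :=
      Finset.sum_nonneg fun v _ => Finset.sum_nonneg fun u _ =>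
        mul_nonneg (adj_nonneg G v u) (sq_nonneg _)
    positivity
  have hE1 : dirichlet (adj G) ψ ≤ Δ / (c * δ) * degree G w := by
    have hΔ0 : 0 < Δ := (hposR w).trans_le (hΔ w)
    have h1 := sum_degree_mul_sq_le G hc hP hΔ hψ0
    have h2 : δ * ∑ v, ψ v ^ 2 ≤ ∑ v, degree G v * ψ v ^ 2 := by
      rw [Finset.mul_sum]
      exact Finset.sum_le_sum fun v _ => mul_le_mul_of_nonneg_right (hδd v) (sq_nonneg _)
    -- Cauchy–Schwarz bounds the squared energy by `d_w ∑ ψ²`, and Poincaré bounds `∑ ψ²` by the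
    -- energy. One factor of the energy cancels.
    have h3 := Finset.sum_mul_sq_le_sq_mul_sq Finset.univ (fun v => adj G w v) ψ
    simp only [adj_sq, sum_adj] at h3
    rw [← hE] at h3
    rcases hE0.eq_or_lt with h0 | h0
    · rw [← h0]
      positivity
    · have h4 : ∑ v, ψ v ^ 2 ≤ Δ / (c * δ) * dirichlet (adj G) ψ := by
        have : Δ / (c * δ) * dirichlet (adj G) ψ = (Δ / c * dirichlet (adj G) ψ) / δ := by
          field_simp
        rw [this, le_div_iff₀ hδ]
        linarith
      have h5 := h3.trans (mul_le_mul_of_nonneg_left h4 (hposR w).le)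
      have h6 : dirichlet (adj G) ψ * dirichlet (adj G) ψ ≤
          (Δ / (c * δ) * degree G w) * dirichlet (adj G) ψ := by nlinarith
      exact le_of_mul_le_mul_right h6 h0
  have hη0 : 0 ≤ stepOp G ψ w := by
    rw [hη]
    exact div_nonneg hE0 (hposR w).le
  have hη1 : stepOp G ψ w ≤ Δ / (c * δ) := by
    rw [hη, div_le_iff₀ (hposR w)]
    exact hE1
  have hloop0 : 0 ≤ adj G w w / degree G w := div_nonneg (adj_nonneg G w w) (hposR w).le
  have hloop1 : adj G w w / degree G w ≤ 1 / δ :=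
    div_le_div₀ zero_le_one (adj_le_one G w w) hδ (hδd w)
  have hx : H * p - 1 = -2 * p + adj G w w / degree G w + stepOp G ψ w := by
    have h1 := hψP w
    have h2 : φ w = p * H := by simp [hφ, hw]
    rw [show stepOp G φ w = φ w - (1 - p) by linarith, h2] at h1
    linarith
  rw [hx, abs_le]
  constructor <;> linarith [div_pos ((hposR w).trans_le (hΔ w)) (mul_pos hc hδ), one_div_pos.2 hδ]

/-! ### Cheeger's inequality -/

lemma Poincare.mono {a b : Fin N → Fin N → ℝ} {c : ℝ} (hP : Poincare a c)
    (hab : ∀ v w, a v w ≤ b v w) : Poincare b c := by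
  intro f
  obtain ⟨m, hm⟩ := hP f
  refine ⟨m, hm.trans ?_⟩
  unfold dirichlet
  have : ∑ v, ∑ w, a v w * (f v - f w) ^ 2 ≤ ∑ v, ∑ w, b v w * (f v - f w) ^ 2 :=
    Finset.sum_le_sum fun v _ => Finset.sum_le_sum fun w _ =>
      mul_le_mul_of_nonneg_right (hab v w) (sq_nonneg _)
  linarith

/-- The total weight of the pairs with one end in `S` and the other end outside. -/
def cut (a : Fin N → Fin N → ℝ) (S : Finset (Fin N)) : ℝ := ∑ v ∈ S, ∑ w ∈ Sᶜ, a v w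

lemma sum_abs_indicator_sub (a : Fin N → Fin N → ℝ) (ha : ∀ v w, a v w = a w v)
    (S : Finset (Fin N)) :
    ∑ v, ∑ w, a v w * |(if v ∈ S then (1 : ℝ) else 0) - if w ∈ S then 1 else 0| =
      2 * cut a S := by
  have h1 : ∑ v ∈ S, ∑ w, a v w * |(if v ∈ S then (1 : ℝ) else 0) - if w ∈ S then 1 else 0| =
      cut a S := by
    refine Finset.sum_congr rfl fun v hv => ?_
    rw [← Finset.sum_add_sum_compl S,
      Finset.sum_eq_zero (s := S) (fun w hw => by simp [hv, hw]), zero_add]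
    exact Finset.sum_congr rfl fun w hw => by simp [hv, Finset.mem_compl.1 hw]
  have h2 : ∑ v ∈ Sᶜ, ∑ w, a v w * |(if v ∈ S then (1 : ℝ) else 0) - if w ∈ S then 1 else 0| =
      cut a S := by
    have : ∀ v ∈ Sᶜ,
        ∑ w, a v w * |(if v ∈ S then (1 : ℝ) else 0) - if w ∈ S then 1 else 0| =
          ∑ w ∈ S, a v w := by
      intro v hv
      have hv' := Finset.mem_compl.1 hv
      rw [← Finset.sum_add_sum_compl S,
        Finset.sum_eq_zero (s := Sᶜ) (fun w hw => by simp [hv', Finset.mem_compl.1 hw]), add_zero]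
      exact Finset.sum_congr rfl fun w hw => by simp [hv', hw]
    rw [Finset.sum_congr rfl this, Finset.sum_comm, cut]
    exact Finset.sum_congr rfl fun v _ => Finset.sum_congr rfl fun w _ => ha w v
  rw [← Finset.sum_add_sum_compl S, h1, h2]
  ring

/-- The `L¹` Sobolev inequality that follows from an isoperimetric inequality. -/
lemma isoperimetric_sum_le {a : Fin N → Fin N → ℝ} (ha : ∀ v w, a v w = a w v) {h : ℝ}
    (hcut : ∀ S : Finset (Fin N), 2 * S.card ≤ N → h * S.card ≤ cut a S)
    (g : Fin N → ℝ) (hg : ∀ v, 0 ≤ g v)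
    (hsupp : 2 * (Finset.univ.filter fun v => 0 < g v).card ≤ N) :
    h * ∑ v, g v ≤ (∑ v, ∑ w, a v w * |g v - g w|) / 2 := by
  induction hn : (Finset.univ.filter fun v => 0 < g v).card using Nat.strong_induction_on
    generalizing g with
  | _ n ih =>
    set S := Finset.univ.filter fun v => 0 < g v with hS
    have hmemS : ∀ v, v ∈ S ↔ 0 < g v := fun v => by simp [hS]
    rcases S.eq_empty_or_nonempty with hemp | hne
    · have h0 : ∀ v, g v = 0 := fun v => by
        refine le_antisymm (not_lt.1 fun hv => ?_) (hg v)
        have := (hmemS v).2 hv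
        simp [hemp] at this
      simp [h0]
    · obtain ⟨v₀, hv₀, hmin⟩ := S.exists_min_image g hne
      set m := g v₀ with hm
      have hm0 : 0 < m := (hmemS v₀).1 hv₀
      -- Layer-cake induction: lowering `g` by its least positive value strictly shrinks the
      -- support, and both sides split exactly into the removed layer and the rest.
      set g' : Fin N → ℝ := fun v => g v - m * if v ∈ S then 1 else 0 with hg'
      have hout : ∀ v, v ∉ S → g v = 0 := fun v hv =>
        le_antisymm (not_lt.1 fun h => hv ((hmemS v).2 h)) (hg v)
      have hg'0 : ∀ v, 0 ≤ g' v := by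
        intro v
        by_cases hv : v ∈ S
        · simpa [hg', hv] using hmin v hv
        · simp [hg', hv, hout v hv]
      have hsub : (Finset.univ.filter fun v => 0 < g' v) ⊂ S := by
        refine (Finset.ssubset_iff_of_subset fun v hv => ?_).2 ⟨v₀, hv₀, ?_⟩
        · have hv' := (Finset.mem_filter.1 hv).2
          by_contra hvS
          simp [hg', hvS, hout v hvS] at hv'
        · simp [hg', hv₀, hm]
      have hcard := Finset.card_lt_card hsub
      have key := ih _ (hn ▸ hcard) g' hg'0 (by omega) rfl
      have h1 : ∑ v, g v = ∑ v, g' v + m * S.card := by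
        simp [hg', Finset.sum_sub_distrib, mul_comm m]
      have h2 : ∑ v, ∑ w, a v w * |g v - g w| =
          ∑ v, ∑ w, a v w * |g' v - g' w| + m * (2 * cut a S) := by
        rw [← sum_abs_indicator_sub a ha S, Finset.mul_sum, ← Finset.sum_add_distrib]
        refine Finset.sum_congr rfl fun v _ => ?_
        rw [Finset.mul_sum, ← Finset.sum_add_distrib]
        refine Finset.sum_congr rfl fun w _ => ?_
        have : |g v - g w| = |g' v - g' w| +
            m * |(if v ∈ S then (1 : ℝ) else 0) - if w ∈ S then 1 else 0| := by
          by_cases hv : v ∈ S <;> by_cases hw : w ∈ S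
          · simp [hg', hv, hw]
          · have h3 := hmin v hv
            simp only [hg', hv, hw, if_true, if_false, hout w hw]
            rw [abs_of_nonneg (by linarith), abs_of_nonneg (by linarith)]
            norm_num
          · have h3 := hmin w hw
            simp only [hg', hv, hw, if_true, if_false, hout v hv]
            rw [abs_of_nonpos (by linarith), abs_of_nonpos (by linarith)]
            norm_num
          · simp [hg', hv, hw]
        rw [this]
        ring
      have h3 := mul_le_mul_of_nonneg_left (hcut S hsupp) hm0.le
      rw [h1, h2]
      linarith

/-- Take the least value of `f` with at most half of the vertices strictly above it. Were more than
half strictly below, the next smaller value would already qualify. -/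
lemma exists_median (f : Fin N → ℝ) (hN : 0 < N) :
    ∃ m, 2 * (Finset.univ.filter fun v => m < f v).card ≤ N ∧
      2 * (Finset.univ.filter fun v => f v < m).card ≤ N := by
  set T := Finset.univ.filter fun v => 2 * (Finset.univ.filter fun u => f v < f u).card ≤ N with hT
  have hne : T.Nonempty := by
    obtain ⟨v, -, hv⟩ := Finset.exists_max_image Finset.univ f ⟨⟨0, hN⟩, Finset.mem_univ _⟩
    refine ⟨v, Finset.mem_filter.2 ⟨Finset.mem_univ _, ?_⟩⟩
    rw [Finset.filter_eq_empty_iff.2 fun u hu => not_lt.2 (hv u hu)]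
    simp
  obtain ⟨v₀, hv₀, hmin⟩ := T.exists_min_image f hne
  refine ⟨f v₀, (Finset.mem_filter.1 hv₀).2, ?_⟩
  by_contra! hlt
  have hne' : (Finset.univ.filter fun v => f v < f v₀).Nonempty := by
    rw [← Finset.card_pos]
    omega
  obtain ⟨v₁, hv₁, hmax⟩ := Finset.exists_max_image _ f hne'
  have hv₁' := (Finset.mem_filter.1 hv₁).2
  have hsub : (Finset.univ.filter fun u => f v₁ < f u) ⊆
      (Finset.univ.filter fun v => f v < f v₀)ᶜ := by
    intro u hu
    rw [Finset.mem_compl]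
    intro hu'
    exact absurd (hmax u hu') (not_le.2 (Finset.mem_filter.1 hu).2)
  have hcard := Finset.card_le_card hsub
  rw [Finset.card_compl, Fintype.card_fin] at hcard
  have : v₁ ∈ T := Finset.mem_filter.2 ⟨Finset.mem_univ _, by omega⟩
  exact absurd (hmin v₁ this) (not_le.2 hv₁')

/-- Lets Cheeger's argument treat the parts above and below the median together without losing a
factor. -/
lemma abs_sq_posPart_sub_add_le (x y : ℝ) :
    |max x 0 ^ 2 - max y 0 ^ 2| + |max (-x) 0 ^ 2 - max (-y) 0 ^ 2| ≤
      |x - y| * (|x| + |y|) := by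
  have hsq : |x ^ 2 - y ^ 2| ≤ |x - y| * (|x| + |y|) := by
    rw [show x ^ 2 - y ^ 2 = (x - y) * (x + y) by ring, abs_mul]
    exact mul_le_mul_of_nonneg_left (abs_add_le x y) (abs_nonneg _)
  rcases le_total 0 x with hx | hx <;> rcases le_total 0 y with hy | hy
  · rw [max_eq_left hx, max_eq_left hy, max_eq_right (by linarith), max_eq_right (by linarith)]
    simpa using hsq
  · rw [max_eq_left hx, max_eq_right hy, max_eq_right (by linarith), max_eq_left (by linarith),
      abs_of_nonneg hx, abs_of_nonpos hy, abs_of_nonneg (a := x - y) (by linarith)]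
    norm_num
    nlinarith
  · rw [max_eq_right hx, max_eq_left hy, max_eq_left (by linarith), max_eq_right (by linarith),
      abs_of_nonpos hx, abs_of_nonneg hy, abs_of_nonpos (a := x - y) (by linarith)]
    norm_num
    nlinarith
  · rw [max_eq_right hx, max_eq_right hy, max_eq_left (by linarith), max_eq_left (by linarith)]
    simpa using hsq

/-- **Cheeger's inequality**: an isoperimetric inequality implies a Poincaré inequality. -/
theorem poincare_of_isoperimetric {a : Fin N → Fin N → ℝ} (hN : 0 < N)
    (ha : ∀ v w, a v w = a w v) (ha0 : ∀ v w, 0 ≤ a v w) {h D : ℝ} (hh : 0 < h) (hD : 0 < D)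
    (hrow : ∀ v, ∑ w, a v w ≤ D)
    (hcut : ∀ S : Finset (Fin N), 2 * S.card ≤ N → h * S.card ≤ cut a S) :
    Poincare a (h ^ 2 / (2 * D)) := by
  intro f
  obtain ⟨m, hm1, hm2⟩ := exists_median f hN
  refine ⟨m, ?_⟩
  set F : Fin N → ℝ := fun v => f v - m with hF
  have hpos := isoperimetric_sum_le ha hcut (fun v => max (F v) 0 ^ 2) (fun v => sq_nonneg _) (by
    refine le_trans (Nat.mul_le_mul_left _ (Finset.card_le_card fun v hv => ?_)) hm1
    have := (Finset.mem_filter.1 hv).2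
    refine Finset.mem_filter.2 ⟨Finset.mem_univ _, ?_⟩
    by_contra! hle
    rw [max_eq_right (by simp only [hF]; linarith)] at this
    simp at this)
  have hneg := isoperimetric_sum_le ha hcut (fun v => max (-F v) 0 ^ 2) (fun v => sq_nonneg _) (by
    refine le_trans (Nat.mul_le_mul_left _ (Finset.card_le_card fun v hv => ?_)) hm2
    have := (Finset.mem_filter.1 hv).2
    refine Finset.mem_filter.2 ⟨Finset.mem_univ _, ?_⟩
    by_contra! hle
    rw [max_eq_right (by simp only [hF]; linarith)] at this
    simp at this)
  have hsplit : ∑ v, F v ^ 2 = ∑ v, max (F v) 0 ^ 2 + ∑ v, max (-F v) 0 ^ 2 := by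
    rw [← Finset.sum_add_distrib]
    refine Finset.sum_congr rfl fun v _ => ?_
    rcases le_total 0 (F v) with hv | hv
    · rw [max_eq_left hv, max_eq_right (by linarith)]
      ring
    · rw [max_eq_right hv, max_eq_left (by linarith)]
      ring
  have hsum : ∑ v, ∑ w, a v w * |max (F v) 0 ^ 2 - max (F w) 0 ^ 2| +
      ∑ v, ∑ w, a v w * |max (-F v) 0 ^ 2 - max (-F w) 0 ^ 2| ≤
      ∑ v, ∑ w, a v w * (D / h * (F v - F w) ^ 2 + h / (2 * D) * (F v ^ 2 + F w ^ 2)) := by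
    rw [← Finset.sum_add_distrib]
    refine Finset.sum_le_sum fun v _ => ?_
    rw [← Finset.sum_add_distrib]
    refine Finset.sum_le_sum fun w _ => ?_
    rw [← mul_add]
    refine mul_le_mul_of_nonneg_left ((abs_sq_posPart_sub_add_le _ _).trans ?_) (ha0 v w)
    set A := |F v - F w| with hA
    set B := |F v| + |F w| with hB
    have hA2 : (F v - F w) ^ 2 = A ^ 2 := (sq_abs _).symm
    have hB2 : B ^ 2 ≤ 2 * (F v ^ 2 + F w ^ 2) := by
      rw [← sq_abs (F v), ← sq_abs (F w)]
      nlinarith [sq_nonneg (|F v| - |F w|)]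
    -- AM-GM weighted so that, after summation, the second term costs `h ∑ F²`, half of the `2 h ∑
    -- F²` supplied by `hpos` and `hneg`.
    have h1 : A * B ≤ D / h * A ^ 2 + h / (4 * D) * B ^ 2 := by
      have : D / h * A ^ 2 + h / (4 * D) * B ^ 2 - A * B =
          (D / h) * (A - h / (2 * D) * B) ^ 2 := by
        field_simp
        ring
      have : 0 ≤ (D / h) * (A - h / (2 * D) * B) ^ 2 := by positivity
      linarith
    have h2 : h / (4 * D) * B ^ 2 ≤ h / (4 * D) * (2 * (F v ^ 2 + F w ^ 2)) :=
      mul_le_mul_of_nonneg_left hB2 (by positivity)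
    have h3 : h / (4 * D) * (2 * (F v ^ 2 + F w ^ 2)) = h / (2 * D) * (F v ^ 2 + F w ^ 2) := by
      field_simp
      ring
    rw [hA2]
    linarith
  have hE : ∑ v, ∑ w, a v w * (D / h * (F v - F w) ^ 2 + h / (2 * D) * (F v ^ 2 + F w ^ 2)) =
      2 * (D / h) * dirichlet a f + h / (2 * D) *
        (∑ v, ∑ w, a v w * F v ^ 2 + ∑ v, ∑ w, a v w * F w ^ 2) := by
    have : dirichlet a f = (∑ v, ∑ w, a v w * (F v - F w) ^ 2) / 2 := by
      simp [dirichlet, hF]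
    rw [this, mul_comm 2 (D / h), mul_assoc, mul_div_cancel₀ _ (two_ne_zero), Finset.mul_sum,
      ← Finset.sum_add_distrib, Finset.mul_sum, ← Finset.sum_add_distrib]
    refine Finset.sum_congr rfl fun v _ => ?_
    rw [Finset.mul_sum, ← Finset.sum_add_distrib, Finset.mul_sum, ← Finset.sum_add_distrib]
    exact Finset.sum_congr rfl fun w _ => by ring
  have hr1 : ∑ v, ∑ w, a v w * F v ^ 2 ≤ D * ∑ v, F v ^ 2 := by
    rw [Finset.mul_sum]
    refine Finset.sum_le_sum fun v _ => ?_
    rw [← Finset.sum_mul]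
    exact mul_le_mul_of_nonneg_right (hrow v) (sq_nonneg _)
  have hr2 : ∑ v, ∑ w, a v w * F w ^ 2 = ∑ v, ∑ w, a v w * F v ^ 2 := by
    rw [Finset.sum_comm]
    exact Finset.sum_congr rfl fun v _ => Finset.sum_congr rfl fun w _ => by rw [ha]
  have hr3 : h / (2 * D) * (∑ v, ∑ w, a v w * F v ^ 2 + ∑ v, ∑ w, a v w * F w ^ 2) ≤
      h * ∑ v, F v ^ 2 := by
    rw [hr2]
    have := mul_le_mul_of_nonneg_left hr1 (show 0 ≤ h / D by positivity)
    calc _ = h / D * ∑ v, ∑ w, a v w * F v ^ 2 := by field_simp; ring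
      _ ≤ _ := this
      _ = _ := by field_simp
  have hfin : h * ∑ v, F v ^ 2 ≤ 2 * (D / h) * dirichlet a f := by
    rw [hE] at hsum
    rw [hsplit] at hr3 ⊢
    linarith
  calc h ^ 2 / (2 * D) * ∑ v, (f v - m) ^ 2 = h / (2 * D) * (h * ∑ v, F v ^ 2) := by
        simp only [hF]
        field_simp
    _ ≤ h / (2 * D) * (2 * (D / h) * dirichlet a f) :=
        mul_le_mul_of_nonneg_left hfin (by positivity)
    _ = dirichlet a f := by field_simp

/-! ### Chernoff bounds for the number of edges -/

namespace BlockModel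

variable (S : BlockModel N M)

instance : IsProbabilityMeasure S.graphLaw := by
  unfold graphLaw
  infer_instance

end BlockModel

/-- The number of edges of `G` that belong to `E`. -/
def edgeCount (E : Finset (Sym2 (Fin N))) (G : LoopGraph N) : ℝ :=
  ∑ e ∈ E, if G e = true then 1 else 0

namespace BlockModel

variable (S : BlockModel N M)

/-- Independence factorises the moment generating function, and `1 + x ≤ exp x` bounds each factor
by its Poisson counterpart. -/
lemma mgf_edgeCount_le (E : Finset (Sym2 (Fin N))) (t : ℝ) :
    mgf (edgeCount E) S.graphLaw t ≤
      Real.exp ((Real.exp t - 1) * ∑ e ∈ E, (S.edgeProb e : ℝ)) := by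
  have h1 : ∀ G : LoopGraph N, Real.exp (t * edgeCount E G) =
      ∏ e, (if e ∈ E then (if G e = true then Real.exp t else 1) else 1) := by
    intro G
    rw [edgeCount, Finset.mul_sum, Real.exp_sum, Finset.prod_ite_mem, Finset.univ_inter]
    refine Finset.prod_congr rfl fun e _ => ?_
    split_ifs <;> simp
  have h2 : mgf (edgeCount E) S.graphLaw t =
      ∏ e, ((S.edgeProb e : ℝ) * (if e ∈ E then Real.exp t else 1) +
        (1 - (S.edgeProb e : ℝ))) := by
    rw [mgf]
    simp only [h1]
    rw [graphLaw, integral_fintype_prod_eq_prod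
      (fun e (b : Bool) => (if e ∈ E then (if b = true then Real.exp t else 1) else 1 : ℝ))]
    refine Finset.prod_congr rfl fun e _ => ?_
    rw [integral_bernoulliMeasure]
    simp
  rw [h2, Finset.mul_sum, Real.exp_sum]
  have h3 : ∀ e, (S.edgeProb e : ℝ) * (if e ∈ E then Real.exp t else 1) +
      (1 - (S.edgeProb e : ℝ)) =
      if e ∈ E then (S.edgeProb e : ℝ) * Real.exp t + (1 - (S.edgeProb e : ℝ)) else 1 := by
    intro e
    split_ifs
    · rfl
    · ring
  simp only [h3]
  rw [Finset.prod_ite_mem, Finset.univ_inter]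
  refine Finset.prod_le_prod (fun e _ => ?_) fun e _ => ?_
  · have h4 := (S.edgeProb e).2.1
    have h5 := (S.edgeProb e).2.2
    have := Real.exp_pos t
    have : 0 ≤ (S.edgeProb e : ℝ) * Real.exp t := by positivity
    linarith
  · have := Real.add_one_le_exp ((Real.exp t - 1) * (S.edgeProb e : ℝ))
    linarith

lemma measure_edgeCount_ge_le (E : Finset (Sym2 (Fin N))) {δ : ℝ} (hδ0 : 0 ≤ δ) (hδ1 : δ ≤ 1) :
    S.graphLaw.real {G | (1 + δ) * ∑ e ∈ E, (S.edgeProb e : ℝ) ≤ edgeCount E G} ≤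
      Real.exp (-(∑ e ∈ E, (S.edgeProb e : ℝ)) * δ ^ 2 / 4) := by
  set m := ∑ e ∈ E, (S.edgeProb e : ℝ) with hm
  have hm0 : 0 ≤ m := Finset.sum_nonneg fun e _ => (S.edgeProb e).2.1
  -- With `t = δ/2` and `exp t - 1 ≤ t + t²`, the exponent is at most `m (-δ²/2 + δ²/4)`.
  refine (measure_ge_le_exp_mul_mgf (t := δ / 2) _ (by linarith) Integrable.of_finite).trans ?_
  refine (mul_le_mul_of_nonneg_left (S.mgf_edgeCount_le E _) (Real.exp_pos _).le).trans ?_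
  rw [← Real.exp_add, Real.exp_le_exp]
  have h := (abs_le.1 (Real.abs_exp_sub_one_sub_id_le
    (show |δ / 2| ≤ 1 by rw [abs_le]; constructor <;> linarith))).2
  have := mul_le_mul_of_nonneg_right h hm0
  rw [← hm]
  linarith

lemma measure_edgeCount_le_le (E : Finset (Sym2 (Fin N))) {δ : ℝ} (hδ0 : 0 ≤ δ) (hδ1 : δ ≤ 1) :
    S.graphLaw.real {G | edgeCount E G ≤ (1 - δ) * ∑ e ∈ E, (S.edgeProb e : ℝ)} ≤
      Real.exp (-(∑ e ∈ E, (S.edgeProb e : ℝ)) * δ ^ 2 / 4) := by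
  set m := ∑ e ∈ E, (S.edgeProb e : ℝ) with hm
  have hm0 : 0 ≤ m := Finset.sum_nonneg fun e _ => (S.edgeProb e).2.1
  refine (measure_le_le_exp_mul_mgf (t := -(δ / 2)) _ (by linarith)
    Integrable.of_finite).trans ?_
  refine (mul_le_mul_of_nonneg_left (S.mgf_edgeCount_le E _) (Real.exp_pos _).le).trans ?_
  rw [← Real.exp_add, Real.exp_le_exp]
  have h := (abs_le.1 (Real.abs_exp_sub_one_sub_id_le
    (show |-(δ / 2)| ≤ 1 by rw [abs_le]; constructor <;> linarith))).2
  have := mul_le_mul_of_nonneg_right h hm0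
  rw [← hm]
  linarith

/-! ### Degrees and cuts in the block model -/

/-- The adjacency matrix of the graph of the edges between different blocks. -/
def crossAdj (G : LoopGraph N) (v w : Fin N) : ℝ :=
  if S.block v = S.block w then 0 else adj G v w

/-- The expected number of neighbours of a vertex in the other blocks. -/
def crossDegree : ℝ := ((M : ℝ) - 1) * ((N : ℝ) / M) * (S.q : ℝ)

lemma crossAdj_comm (G : LoopGraph N) (v w : Fin N) : S.crossAdj G v w = S.crossAdj G w v := by
  unfold crossAdj
  rw [adj_comm]
  simp only [eq_comm]

lemma crossAdj_nonneg (G : LoopGraph N) (v w : Fin N) : 0 ≤ S.crossAdj G v w := by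
  unfold crossAdj
  split_ifs
  · rfl
  · exact adj_nonneg G v w

lemma crossAdj_le_adj (G : LoopGraph N) (v w : Fin N) : S.crossAdj G v w ≤ adj G v w := by
  unfold crossAdj
  split_ifs
  · exact adj_nonneg G v w
  · rfl

lemma edgeProb_mk (v w : Fin N) :
    (S.edgeProb s(v, w) : ℝ) = if S.block v = S.block w then (S.p (S.block v) : ℝ) else S.q := by
  change ((if S.block v = S.block w then S.p (S.block v) else S.q : I) : ℝ) = _
  split_ifs <;> rfl

lemma card_block_eq (hM : 0 < M) (m : Fin M) :
    ((Finset.univ.filter fun v => S.block v = m).card : ℝ) = (N : ℝ) / M := by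
  have : (M : ℝ) ≠ 0 := by exact_mod_cast hM.ne'
  rw [eq_div_iff this, mul_comm]
  exact_mod_cast S.card_block m

lemma injective_mk (v : Fin N) : Function.Injective fun w => s(v, w) := fun _ _ h =>
  Sym2.congr_right.1 h

lemma edgeCount_star (G : LoopGraph N) (v : Fin N) (T : Finset (Fin N)) :
    edgeCount (T.image fun w => s(v, w)) G = ∑ w ∈ T, adj G v w := by
  rw [edgeCount, Finset.sum_image ((injective_mk v).injOn)]
  rfl

lemma sum_crossAdj (G : LoopGraph N) (v : Fin N) :
    ∑ w, S.crossAdj G v w =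
      edgeCount ((Finset.univ.filter fun w => S.block v ≠ S.block w).image fun w => s(v, w)) G := by
  rw [edgeCount_star, Finset.sum_filter]
  refine Finset.sum_congr rfl fun w _ => ?_
  unfold crossAdj
  split_ifs <;> simp_all

lemma sum_ne_block (hM : 0 < M) (v : Fin N) :
    ((Finset.univ.filter fun w => S.block v ≠ S.block w).card : ℝ) = ((M : ℝ) - 1) * (N / M) := by
  have hM' : (M : ℝ) ≠ 0 := by exact_mod_cast hM.ne'
  have h1 := Finset.card_filter_add_card_filter_not (s := Finset.univ)
    (fun w : Fin N => S.block v = S.block w)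
  have h2 := S.card_block_eq hM (S.block v)
  simp only [eq_comm (b := S.block v)] at h2
  rw [Finset.card_univ, Fintype.card_fin] at h1
  have h3 : ((Finset.univ.filter fun w => S.block v = S.block w).card : ℝ) +
      ((Finset.univ.filter fun w => S.block v ≠ S.block w).card : ℝ) = N := by exact_mod_cast h1
  rw [h2] at h3
  have : ((M : ℝ) - 1) * (N / M) = N - N / M := by
    field_simp
  linarith

lemma sum_edgeProb_cross_star (hM : 0 < M) (v : Fin N) :
    ∑ e ∈ (Finset.univ.filter fun w => S.block v ≠ S.block w).image (fun w => s(v, w)),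
      (S.edgeProb e : ℝ) = S.crossDegree := by
  rw [Finset.sum_image ((injective_mk v).injOn), crossDegree, ← S.sum_ne_block hM v,
    ← nsmul_eq_mul, ← Finset.sum_const]
  refine Finset.sum_congr rfl fun w hw => ?_
  rw [edgeProb_mk, if_neg (Finset.mem_filter.1 hw).2]

lemma sum_edgeProb_star (hM : 0 < M) (v : Fin N) :
    ∑ e ∈ Finset.univ.image (fun w => s(v, w)), (S.edgeProb e : ℝ) = S.γ (S.block v) := by
  have h := S.sum_edgeProb_cross_star hM v
  rw [Finset.sum_image ((injective_mk v).injOn)] at h ⊢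
  rw [← Finset.sum_filter_add_sum_filter_not Finset.univ (fun w => S.block v = S.block w), h, γ,
    crossDegree]
  congr 1
  have h2 := S.card_block_eq hM (S.block v)
  simp only [eq_comm (b := S.block v)] at h2
  rw [← h2, ← nsmul_eq_mul, ← Finset.sum_const]
  refine Finset.sum_congr rfl fun w hw => ?_
  rw [edgeProb_mk, if_pos (Finset.mem_filter.1 hw).2]

/-- The pairs of vertices in different blocks, one of them in `T`, the other one outside. -/
def cutPairs (T : Finset (Fin N)) : Finset (Fin N × Fin N) :=
  (T ×ˢ Tᶜ).filter fun z => S.block z.1 ≠ S.block z.2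

/-- Membership in `T` orients the edge, so no unordered pair is counted twice. -/
lemma injOn_cutPairs (T : Finset (Fin N)) :
    Set.InjOn (fun z : Fin N × Fin N => s(z.1, z.2)) (S.cutPairs T) := by
  rintro ⟨a, b⟩ h1 ⟨c, d⟩ h2 h
  simp only [cutPairs, Finset.coe_filter, Finset.mem_product, Finset.mem_compl,
    Set.mem_ofPred_eq] at h1 h2
  rcases Sym2.eq_iff.1 h with ⟨h3, h4⟩ | ⟨h3, h4⟩
  · exact Prod.ext h3 h4
  · subst h3
    exact absurd h1.1.1 h2.1.2

lemma cut_crossAdj (G : LoopGraph N) (T : Finset (Fin N)) :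
    cut (S.crossAdj G) T = edgeCount ((S.cutPairs T).image fun z => s(z.1, z.2)) G := by
  rw [edgeCount, Finset.sum_image (S.injOn_cutPairs T), cutPairs, Finset.sum_filter,
    Finset.sum_product, cut]
  refine Finset.sum_congr rfl fun v _ => Finset.sum_congr rfl fun w _ => ?_
  simp only [crossAdj, adj]
  split_ifs <;> simp_all

lemma sum_edgeProb_cutPairs (T : Finset (Fin N)) :
    ∑ e ∈ (S.cutPairs T).image (fun z => s(z.1, z.2)), (S.edgeProb e : ℝ) =
      (S.cutPairs T).card * (S.q : ℝ) := by
  rw [Finset.sum_image (S.injOn_cutPairs T), ← nsmul_eq_mul, ← Finset.sum_const]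
  refine Finset.sum_congr rfl fun z hz => ?_
  rw [edgeProb_mk, if_neg (Finset.mem_filter.1 hz).2]

/-- If `T` has `s_m` vertices in block `m`, the discarded pairs number `∑ s_m (N/M - s_m)`. By
Cauchy–Schwarz this is largest when `T` is spread evenly over the blocks. -/
lemma card_cutPairs (hM : 0 < M) (T : Finset (Fin N)) :
    (T.card : ℝ) * (N - T.card) * (((M : ℝ) - 1) / M) ≤ (S.cutPairs T).card := by
  have hM' : (0 : ℝ) < M := by exact_mod_cast hM
  set s : Fin M → ℝ := fun m => ((T.filter fun v => S.block v = m).card : ℝ) with hs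
  have hsum : ∑ m, s m = T.card := by
    have := Finset.card_eq_sum_card_fiberwise (f := S.block) (s := T) (t := Finset.univ)
      (fun _ _ => Finset.mem_univ _)
    rw [this]
    simp [hs]
  have hcompl : ∀ m, ((Tᶜ.filter fun v => S.block v = m).card : ℝ) = N / M - s m := by
    intro m
    have h1 := S.card_block_eq hM m
    have h2 : (Finset.univ.filter fun v => S.block v = m).card =
        (T.filter fun v => S.block v = m).card + (Tᶜ.filter fun v => S.block v = m).card := by
      rw [← Finset.card_union_of_disjoint, ← Finset.filter_union, Finset.union_compl]
      exact Finset.disjoint_filter_filter disjoint_compl_right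
    rw [← h1, h2]
    push_cast
    simp [hs]
  have hsame : (((T ×ˢ Tᶜ).filter fun z => S.block z.1 = S.block z.2).card : ℝ) =
      ∑ m, s m * (N / M - s m) := by
    have h1 := Finset.card_eq_sum_card_fiberwise (f := fun z : Fin N × Fin N => S.block z.1)
      (s := (T ×ˢ Tᶜ).filter fun z => S.block z.1 = S.block z.2) (t := Finset.univ)
      (fun _ _ => Finset.mem_univ _)
    rw [h1]
    push_cast
    refine Finset.sum_congr rfl fun m _ => ?_
    rw [← hcompl m]
    simp only [hs]
    rw [← Nat.cast_mul, ← Finset.card_product]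
    congr 2
    ext ⟨v, w⟩
    simp only [Finset.mem_filter, Finset.mem_product]
    constructor
    · rintro ⟨⟨⟨h1, h2⟩, h3⟩, h4⟩
      exact ⟨⟨h1, h4⟩, h2, h3 ▸ h4⟩
    · rintro ⟨⟨h1, h4⟩, h2, h3⟩
      exact ⟨⟨⟨h1, h2⟩, h4.trans h3.symm⟩, h4⟩
  have htot : (((T ×ˢ Tᶜ).filter fun z => S.block z.1 = S.block z.2).card : ℝ) +
      (S.cutPairs T).card = T.card * (N - T.card) := by
    have h1 := Finset.card_filter_add_card_filter_not (s := T ×ˢ Tᶜ)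
      (fun z => S.block z.1 = S.block z.2)
    rw [Finset.card_product, Finset.card_compl, Fintype.card_fin] at h1
    have h2 : T.card ≤ N := by simpa using Finset.card_le_univ T
    have h3 : ((T.card * (N - T.card) : ℕ) : ℝ) = T.card * (N - T.card) := by
      push_cast [Nat.cast_sub h2]
      ring
    rw [← h3, ← h1]
    push_cast
    rfl
  have hcs : (T.card : ℝ) ^ 2 ≤ M * ∑ m, s m ^ 2 := by
    have := sq_sum_le_card_mul_sum_sq (s := (Finset.univ : Finset (Fin M))) (f := s)
    rwa [hsum, Finset.card_univ, Fintype.card_fin] at this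
  have hexp : ∑ m, s m * ((N : ℝ) / M - s m) = N / M * T.card - ∑ m, s m ^ 2 := by
    rw [← hsum, Finset.mul_sum, ← Finset.sum_sub_distrib]
    exact Finset.sum_congr rfl fun m _ => by ring
  rw [hsame, hexp] at htot
  have h5 : (T.card : ℝ) ^ 2 / M ≤ ∑ m, s m ^ 2 := by
    rw [div_le_iff₀ hM', mul_comm]
    exact hcs
  have h6 : (T.card : ℝ) * (N - T.card) * (((M : ℝ) - 1) / M) =
      T.card * (N - T.card) - N / M * T.card + T.card ^ 2 / M := by
    field_simp
    ring
  linarith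

lemma crossDegree_nonneg (hM : 0 < M) : 0 ≤ S.crossDegree := by
  have : (1 : ℝ) ≤ M := by exact_mod_cast hM
  exact mul_nonneg (mul_nonneg (by linarith) (by positivity)) S.q.2.1

lemma le_sum_edgeProb_cutPairs (hM : 0 < M) {T : Finset (Fin N)} (hT : 2 * T.card ≤ N) :
    S.crossDegree * T.card / 2 ≤
      ∑ e ∈ (S.cutPairs T).image (fun z => s(z.1, z.2)), (S.edgeProb e : ℝ) := by
  rw [sum_edgeProb_cutPairs]
  refine le_trans ?_ (mul_le_mul_of_nonneg_right (S.card_cutPairs hM T) S.q.2.1)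
  have hM1 : (1 : ℝ) ≤ M := by exact_mod_cast hM
  have hM' : (0 : ℝ) < M := by linarith
  have hT' : 2 * (T.card : ℝ) ≤ N := by exact_mod_cast hT
  have hq : (0 : ℝ) ≤ S.q := S.q.2.1
  have h1 : 0 ≤ ((M : ℝ) - 1) / M * T.card * S.q :=
    mul_nonneg (mul_nonneg (div_nonneg (by linarith) hM'.le) (Nat.cast_nonneg _)) hq
  have h2 : S.crossDegree * T.card / 2 = (((M : ℝ) - 1) / M * T.card * S.q) * (N / 2) := by
    rw [crossDegree]
    ring
  rw [h2]
  calc _ ≤ (((M : ℝ) - 1) / M * T.card * S.q) * (N - T.card) :=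
        mul_le_mul_of_nonneg_left (by linarith) h1
    _ = _ := by ring

/-! ### The typical graph -/

/-- The properties of the graph that hold with high probability: the degrees are close to their
expectations, and the edges between the blocks satisfy an isoperimetric inequality. -/
structure IsTypical (δ : ℝ) (G : LoopGraph N) : Prop where
  degree_lt : ∀ v, (degree G v : ℝ) < (1 + δ) * S.γ (S.block v)
  lt_degree : ∀ v, (1 - δ) * S.γ (S.block v) < degree G v
  sum_crossAdj_lt : ∀ v, ∑ w, S.crossAdj G v w < 2 * S.crossDegree
  le_cut : ∀ T : Finset (Fin N), 2 * T.card ≤ N →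
    S.crossDegree / 4 * T.card ≤ cut (S.crossAdj G) T

lemma γmin_le (m : Fin M) : S.γmin ≤ S.γ m := ciInf_le (Set.finite_range _).bddBelow m

lemma le_γmax (m : Fin M) : S.γ m ≤ S.γmax := le_ciSup (Set.finite_range _).bddAbove m

lemma degree_eq_edgeCount (G : LoopGraph N) (v : Fin N) :
    (degree G v : ℝ) = edgeCount (Finset.univ.image fun w => s(v, w)) G := by
  rw [edgeCount_star, sum_adj]

/-- The binomial theorem performs the union bound over all nonempty sets; the result is small once
`N x` is. -/
lemma sum_pow_card_le (x : ℝ) (hx : 0 ≤ x) :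
    ∑ T ∈ (Finset.univ : Finset (Finset (Fin N))).erase ∅, x ^ T.card ≤ Real.exp (N * x) - 1 := by
  have h1 := Fintype.sum_pow_mul_eq_add_pow (Fin N) x 1
  simp only [one_pow, mul_one, Fintype.card_fin] at h1
  have h2 := Finset.sum_erase_add (Finset.univ : Finset (Finset (Fin N)))
    (fun T => x ^ T.card) (Finset.mem_univ ∅)
  rw [h1] at h2
  have h3 : (x + 1) ^ N ≤ Real.exp (N * x) := by
    rw [Real.exp_nat_mul]
    exact pow_le_pow_left₀ (by linarith) (Real.add_one_le_exp x) N
  simp only [Finset.card_empty, pow_zero] at h2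
  linarith

theorem measure_not_isTypical_le (hM : 0 < M) {δ : ℝ} (hδ0 : 0 < δ) (hδ1 : δ ≤ 1) :
    S.graphLaw.real {G | ¬ S.IsTypical δ G} ≤
      2 * (N * Real.exp (-S.γmin * δ ^ 2 / 4)) + N * Real.exp (-S.crossDegree / 4) +
        (Real.exp (N * Real.exp (-S.crossDegree / 32)) - 1) := by
  set A₁ : Fin N → Set (LoopGraph N) := fun v => {G | (1 + δ) * S.γ (S.block v) ≤ degree G v}
  set A₂ : Fin N → Set (LoopGraph N) := fun v => {G | (degree G v : ℝ) ≤ (1 - δ) * S.γ (S.block v)}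
  set A₃ : Fin N → Set (LoopGraph N) := fun v => {G | 2 * S.crossDegree ≤ ∑ w, S.crossAdj G v w}
  set A₄ : Finset (Fin N) → Set (LoopGraph N) := fun T =>
    {G | 2 * T.card ≤ N ∧ cut (S.crossAdj G) T < S.crossDegree / 4 * T.card}
  have hsub : {G | ¬ S.IsTypical δ G} ⊆ ((⋃ v, A₁ v) ∪ (⋃ v, A₂ v)) ∪ (⋃ v, A₃ v) ∪
      ⋃ T ∈ (Finset.univ : Finset (Finset (Fin N))).erase ∅, A₄ T := by
    intro G hG
    by_contra hnot
    simp only [Set.mem_union, Set.mem_iUnion, not_or, not_exists] at hnot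
    obtain ⟨⟨⟨h1, h2⟩, h3⟩, h4⟩ := hnot
    refine hG ⟨fun v => not_le.1 (h1 v), fun v => not_le.1 (h2 v), fun v => not_le.1 (h3 v),
      fun T hT => ?_⟩
    rcases eq_or_ne T ∅ with rfl | hne
    · simp [cut]
    · exact not_lt.1 fun hlt => h4 T (by simp [hne]) ⟨hT, hlt⟩
  have hγ : ∀ v, Real.exp (-S.γ (S.block v) * δ ^ 2 / 4) ≤ Real.exp (-S.γmin * δ ^ 2 / 4) := by
    intro v
    have := mul_le_mul_of_nonneg_right (S.γmin_le (S.block v)) (sq_nonneg δ)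
    rw [Real.exp_le_exp]
    linarith
  have hA₁ : ∀ v, S.graphLaw.real (A₁ v) ≤ Real.exp (-S.γmin * δ ^ 2 / 4) := by
    intro v
    have := S.measure_edgeCount_ge_le (Finset.univ.image fun w => s(v, w)) hδ0.le hδ1
    simp only [S.sum_edgeProb_star hM, ← degree_eq_edgeCount] at this
    exact this.trans (hγ v)
  have hA₂ : ∀ v, S.graphLaw.real (A₂ v) ≤ Real.exp (-S.γmin * δ ^ 2 / 4) := by
    intro v
    have := S.measure_edgeCount_le_le (Finset.univ.image fun w => s(v, w)) hδ0.le hδ1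
    simp only [S.sum_edgeProb_star hM, ← degree_eq_edgeCount] at this
    exact this.trans (hγ v)
  have hA₃ : ∀ v, S.graphLaw.real (A₃ v) ≤ Real.exp (-S.crossDegree / 4) := by
    intro v
    have := S.measure_edgeCount_ge_le
      ((Finset.univ.filter fun w => S.block v ≠ S.block w).image fun w => s(v, w))
      zero_le_one le_rfl
    simp only [S.sum_edgeProb_cross_star hM, ← sum_crossAdj] at this
    norm_num at this
    exact this
  -- The threshold is half of the lower bound `y |T| / 2` for the mean. Chernoff with deviation
  -- `1/2` gives `exp (-mean/16)`, at most `exp (-y |T| / 32)`.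
  have hA₄ : ∀ T, S.graphLaw.real (A₄ T) ≤ Real.exp (-S.crossDegree / 32) ^ T.card := by
    intro T
    by_cases hT : 2 * T.card ≤ N
    · have hle := S.le_sum_edgeProb_cutPairs hM hT
      have := S.measure_edgeCount_le_le ((S.cutPairs T).image fun z => s(z.1, z.2))
        (δ := 1 / 2) (by norm_num) (by norm_num)
      simp only [← cut_crossAdj] at this
      rw [← Real.exp_nat_mul]
      refine (measureReal_mono (fun G hG => ?_)).trans (this.trans (Real.exp_le_exp.2 ?_))
      · have := hG.2
        simp only [Set.mem_ofPred_eq]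
        linarith
      · linarith
    · have : A₄ T = ∅ := Set.eq_empty_of_forall_notMem fun G hG => hT hG.1
      rw [this, measureReal_empty]
      positivity
  have hU : ∀ (A : Fin N → Set (LoopGraph N)) (c : ℝ), (∀ v, S.graphLaw.real (A v) ≤ c) →
      S.graphLaw.real (⋃ v, A v) ≤ N * c := by
    intro A c hA
    refine (measureReal_iUnion_fintype_le _).trans ((Finset.sum_le_sum fun v _ => hA v).trans ?_)
    simp
  have hU₄ := (measureReal_biUnion_finset_le (μ := S.graphLaw)
    ((Finset.univ : Finset (Finset (Fin N))).erase ∅) A₄).trans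
    ((Finset.sum_le_sum fun T _ => hA₄ T).trans (sum_pow_card_le _ (Real.exp_pos _).le))
  have e1 := measureReal_mono (μ := S.graphLaw) hsub
  have e2 := measureReal_union_le (μ := S.graphLaw) ((⋃ v, A₁ v) ∪ (⋃ v, A₂ v) ∪ (⋃ v, A₃ v))
    (⋃ T ∈ (Finset.univ : Finset (Finset (Fin N))).erase ∅, A₄ T)
  have e3 := measureReal_union_le (μ := S.graphLaw) ((⋃ v, A₁ v) ∪ (⋃ v, A₂ v)) (⋃ v, A₃ v)
  have e4 := measureReal_union_le (μ := S.graphLaw) (⋃ v, A₁ v) (⋃ v, A₂ v)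
  linarith [hU A₁ _ hA₁, hU A₂ _ hA₂, hU A₃ _ hA₃]

end BlockModel

/-! ### Hitting times of typical graphs -/

lemma abs_mul_sub_one_le {x ρ δ : ℝ} (hδ0 : 0 < δ) (hδ1 : δ ≤ 1 / 2) (hx : |x - 1| ≤ δ)
    (hρ0 : 0 ≤ ρ) (hρ1 : ρ * (1 - δ) ≤ 1 + δ) (hρ2 : 1 - δ ≤ ρ * (1 + δ)) :
    |x * ρ - 1| ≤ 8 * δ := by
  obtain ⟨hx1, hx2⟩ := abs_le.1 hx
  have hδ2 : 2 * (δ * δ) ≤ δ := by nlinarith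
  have hρ3 : ρ ≤ 1 + 4 * δ := by
    refine le_of_mul_le_mul_right (hρ1.trans ?_) (show 0 < 1 - δ by linarith)
    linarith
  have hρ4 : 1 - 2 * δ ≤ ρ := by
    refine le_of_mul_le_mul_right (le_trans ?_ hρ2) (show 0 < 1 + δ by linarith)
    nlinarith
  have hup : x * ρ ≤ (1 + δ) * (1 + 4 * δ) :=
    mul_le_mul (by linarith) hρ3 hρ0 (by linarith)
  have hlow : (1 - δ) * (1 - 2 * δ) ≤ x * ρ :=
    mul_le_mul (by linarith) hρ4 (by linarith) (by linarith)
  rw [abs_le]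
  constructor <;> nlinarith

namespace BlockModel

variable (S : BlockModel N M)

lemma γ_eq (m : Fin M) : S.γ m = (N : ℝ) / M * (S.p m : ℝ) + S.crossDegree := rfl

lemma γmin_eq (hM : 0 < M) : S.γmin = (N : ℝ) / M * S.pmin + S.crossDegree := by
  have : Nonempty (Fin M) := ⟨⟨0, hM⟩⟩
  obtain ⟨m, hm⟩ := Finite.exists_min fun m => (S.p m : ℝ)
  have h1 : S.pmin = S.p m :=
    le_antisymm (ciInf_le (Set.finite_range _).bddBelow m) (le_ciInf hm)
  have h2 : S.γmin = S.γ m := le_antisymm (S.γmin_le m) (le_ciInf fun m' => by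
    rw [γ_eq, γ_eq]
    gcongr
    exact hm m')
  rw [h2, h1, γ_eq]

lemma γmax_eq (hM : 0 < M) : S.γmax = (N : ℝ) / M * S.pmax + S.crossDegree := by
  have : Nonempty (Fin M) := ⟨⟨0, hM⟩⟩
  obtain ⟨m, hm⟩ := Finite.exists_max fun m => (S.p m : ℝ)
  have h1 : S.pmax = S.p m :=
    le_antisymm (ciSup_le hm) (le_ciSup (f := fun m => (S.p m : ℝ)) (Set.finite_range _).bddAbove m)
  have h2 : S.γmax = S.γ m := le_antisymm (ciSup_le fun m' => by
    rw [γ_eq, γ_eq]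
    gcongr
    exact hm m') (S.le_γmax m)
  rw [h2, h1, γ_eq]

lemma pmin_nonneg : 0 ≤ S.pmin := Real.iInf_nonneg fun m => (S.p m).2.1

lemma pmin_le_pmax (hM : 0 < M) : S.pmin ≤ S.pmax :=
  (ciInf_le (f := fun m => (S.p m : ℝ)) (Set.finite_range _).bddBelow ⟨0, hM⟩).trans
    (le_ciSup (f := fun m => (S.p m : ℝ)) (Set.finite_range _).bddAbove ⟨0, hM⟩)

lemma crossDegree_le (hM : 0 < M) : S.crossDegree ≤ N := by
  have hM' : (0 : ℝ) < M := by exact_mod_cast hM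
  have hq := S.q.2.2
  have hM1 : (1 : ℝ) ≤ M := by exact_mod_cast hM
  calc S.crossDegree ≤ ((M : ℝ) - 1) * ((N : ℝ) / M) * 1 :=
        mul_le_mul_of_nonneg_left hq (mul_nonneg (by linarith) (by positivity))
    _ ≤ M * ((N : ℝ) / M) * 1 := by gcongr; linarith
    _ = N := by field_simp

lemma sum_γ_block (hM : 0 < M) : ∑ v, S.γ (S.block v) = (N : ℝ) / M * ∑ m, S.γ m := by
  rw [← Finset.sum_fiberwise (s := Finset.univ) (g := S.block), Finset.mul_sum]
  refine Finset.sum_congr rfl fun m _ => ?_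
  rw [← S.card_block_eq hM m, ← nsmul_eq_mul, ← Finset.sum_const]
  exact Finset.sum_congr rfl fun v hv => by rw [(Finset.mem_filter.1 hv).2]

variable {S} in
-- Cheeger is applied to the cross-block edges only, whose row sums are of order `y`. Using the full
-- degrees would replace the constant `y/64` by one of order `y²/γmax`.
lemma IsTypical.poincare {δ : ℝ} {G : LoopGraph N} (hG : S.IsTypical δ G) (hN : 0 < N)
    (hy : 0 < S.crossDegree) : Poincare (adj G) (S.crossDegree / 64) := by
  have h := poincare_of_isoperimetric hN (S.crossAdj_comm G) (S.crossAdj_nonneg G)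
    (h := S.crossDegree / 4) (D := 2 * S.crossDegree) (by positivity) (by positivity)
    (fun v => (hG.sum_crossAdj_lt v).le) hG.le_cut
  have h2 : (S.crossDegree / 4) ^ 2 / (2 * (2 * S.crossDegree)) = S.crossDegree / 64 := by
    field_simp
    norm_num
  rw [h2] at h
  exact h.mono (S.crossAdj_le_adj G)

variable {S} in
theorem IsTypical.abs_averageHittingTime_div_sub_one_le {δ : ℝ} {G : LoopGraph N} (hG : S.IsTypical δ G)
    (hN : 0 < N) (hM : 0 < M) (hy : 0 < S.crossDegree) (hγ : 0 < S.γmin) (hδ0 : 0 < δ)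
    (hδ1 : δ ≤ 1 / 2) (hR : 266 * S.γmax ≤ δ * (S.crossDegree * S.γmin)) (w : Fin N) :
    averageHittingTime G w ≠ ∞ ∧
      |(averageHittingTime G w).toReal /
        ((N : ℝ) / (M : ℝ) * ((∑ m, S.γ m) / S.γ (S.block w))) - 1| ≤ 8 * δ := by
  have hP := hG.poincare hN hy
  have hN' : (0 : ℝ) < N := by exact_mod_cast hN
  have hγv : ∀ v, 0 < S.γ (S.block v) := fun v => hγ.trans_le (S.γmin_le _)
  have hγM : 0 < S.γmax := (hγv w).trans_le (S.le_γmax _)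
  have hlow : ∀ v, S.γmin / 2 ≤ (degree G v : ℝ) := fun v => by
    have h1 := hG.lt_degree v
    have h2 := S.γmin_le (S.block v)
    nlinarith [hγv v]
  have hup : ∀ v, (degree G v : ℝ) ≤ 2 * S.γmax := fun v => by
    have h1 := hG.degree_lt v
    have h2 := S.le_γmax (S.block v)
    nlinarith [hγv v]
  have hpos : ∀ v, 0 < degree G v := fun v => by
    have : (0 : ℝ) < degree G v := lt_of_lt_of_le (by positivity) (hlow v)
    exact_mod_cast this
  refine ⟨averageHittingTime_ne_top G hpos (by positivity) hP w, ?_⟩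
  have key := abs_averageHittingTime_sub_one_le G (by positivity) (by positivity) hP hlow hup w
  set D : ℝ := ∑ v, (degree G v : ℝ) with hD
  set Γ : ℝ := ∑ v, S.γ (S.block v) with hΓ
  set d : ℝ := (degree G w : ℝ) with hd
  set g : ℝ := S.γ (S.block w) with hg
  set y := S.crossDegree with hydef
  set H := (averageHittingTime G w).toReal with hH
  have hd0 : 0 < d := by
    rw [hd]
    exact_mod_cast hpos w
  have hg0 : 0 < g := hγv w
  have hΓ0 : 0 < Γ := Finset.sum_pos (fun v _ => hγv v) ⟨w, Finset.mem_univ w⟩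
  have hD1 : D ≤ (1 + δ) * Γ := by
    rw [hD, hΓ, Finset.mul_sum]
    exact Finset.sum_le_sum fun v _ => (hG.degree_lt v).le
  have hD2 : (1 - δ) * Γ ≤ D := by
    rw [hD, hΓ, Finset.mul_sum]
    exact Finset.sum_le_sum fun v _ => (hG.lt_degree v).le
  have hD0 : 0 < D := lt_of_lt_of_le (mul_pos (by linarith) hΓ0) hD2
  have hr0 : S.γmax / (y * S.γmin) ≤ δ / 266 := by
    rw [div_le_div_iff₀ (by positivity) (by norm_num)]
    linarith
  -- In units of `γmax / (y γmin)` the three terms are at most `8`, `2` and `256`, whence the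
  -- constant `266`.
  have hr : 2 * (d / D) + 1 / (S.γmin / 2) + 2 * S.γmax / (y / 64 * (S.γmin / 2)) ≤ δ := by
    have h1 : d / D ≤ 4 * (S.γmax / (y * S.γmin)) := by
      have hDN : N * (S.γmin / 2) ≤ D := by
        have := Finset.sum_le_sum fun v (_ : v ∈ Finset.univ) => hlow v
        simpa using this
      have hyD : y * (S.γmin / 2) ≤ D :=
        (mul_le_mul_of_nonneg_right (S.crossDegree_le hM) (by positivity)).trans hDN
      calc d / D ≤ (2 * S.γmax) / (y * (S.γmin / 2)) :=
            div_le_div₀ (by positivity) (hup w) (by positivity) hyD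
        _ = _ := by field_simp; norm_num
    have h2 : 1 / (S.γmin / 2) ≤ 2 * (S.γmax / (y * S.γmin)) := by
      have hyγ : y ≤ S.γmax := by
        refine le_trans ?_ (S.le_γmax (S.block w))
        rw [γ_eq]
        have : 0 ≤ (N : ℝ) / M * (S.p (S.block w) : ℝ) :=
          mul_nonneg (by positivity) (S.p _).2.1
        linarith
      calc 1 / (S.γmin / 2) = 2 * (y / (y * S.γmin)) := by field_simp
        _ ≤ _ := by gcongr
    have h3 : 2 * S.γmax / (y / 64 * (S.γmin / 2)) = 256 * (S.γmax / (y * S.γmin)) := by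
      field_simp
      norm_num
    rw [h3]
    linarith
  rw [show (N : ℝ) / M * ((∑ m, S.γ m) / g) = Γ / g by rw [hΓ, S.sum_γ_block hM]; ring]
  -- The first factor is `π_w H_w`. The second compares the realised `1 / π_w` with its
  -- deterministic counterpart `Γ / g`.
  have hρ : H / (Γ / g) = (H * (d / D)) * ((D * g) / (Γ * d)) := by
    field_simp
  have hdlt := (hG.degree_lt w).le
  have hltd := (hG.lt_degree w).le
  rw [← hd, ← hg] at hdlt hltd
  set x := H * (d / D) with hxdef
  set ρ := (D * g) / (Γ * d) with hρdef
  have hρ1 : ρ * (1 - δ) ≤ 1 + δ := by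
    have : ρ ≤ (1 + δ) / (1 - δ) := by
      rw [hρdef, div_le_div_iff₀ (by positivity) (by linarith)]
      calc D * g * (1 - δ) = D * ((1 - δ) * g) := by ring
        _ ≤ ((1 + δ) * Γ) * d := mul_le_mul hD1 hltd (mul_nonneg (by linarith) hg0.le)
            (by positivity)
        _ = _ := by ring
    rwa [le_div_iff₀ (by linarith)] at this
  have hρ2 : 1 - δ ≤ ρ * (1 + δ) := by
    have : (1 - δ) / (1 + δ) ≤ ρ := by
      rw [hρdef, div_le_div_iff₀ (by linarith) (by positivity)]
      calc (1 - δ) * (Γ * d) = ((1 - δ) * Γ) * d := by ring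
        _ ≤ D * ((1 + δ) * g) := mul_le_mul hD2 hdlt hd0.le hD0.le
        _ = _ := by ring
    rwa [div_le_iff₀ (by linarith)] at this
  have hρ0 : 0 < ρ := by positivity
  rw [hρ]
  exact abs_mul_sub_one_le hδ0 hδ1 (key.trans hr) hρ0.le hρ1 hρ2

end BlockModel

/-! ### Consequences of the assumptions on the parameters -/

/-- The comparison of the mixed power in the cross-block condition with a product. -/
lemma mul_le_mixed_rpow {s L p P : ℝ} (hs : 0 < s) (hL : 1 ≤ L) (hsp : s ≤ p) (hpP : p ≤ P) :
    s * p ≤ (s * L) ^ (1 / 4 : ℝ) * p ^ (5 / 4 : ℝ) * P ^ (1 / 2 : ℝ) := by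
  have hp : 0 < p := hs.trans_le hsp
  have h1 : s ^ (1 / 4 : ℝ) ≤ (s * L) ^ (1 / 4 : ℝ) :=
    Real.rpow_le_rpow hs.le (le_mul_of_one_le_right hs.le hL) (by norm_num)
  have h2 : p * s ^ (1 / 4 : ℝ) ≤ p ^ (5 / 4 : ℝ) := by
    rw [show (5 / 4 : ℝ) = 1 + 1 / 4 by norm_num, Real.rpow_add hp, Real.rpow_one]
    gcongr
  have h3 : s ^ (1 / 2 : ℝ) ≤ P ^ (1 / 2 : ℝ) :=
    Real.rpow_le_rpow hs.le (hsp.trans hpP) (by norm_num)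
  calc s * p = s ^ (1 / 4 : ℝ) * (p * s ^ (1 / 4 : ℝ)) * s ^ (1 / 2 : ℝ) := by
        have : s ^ (1 / 4 : ℝ) * s ^ (1 / 4 : ℝ) * s ^ (1 / 2 : ℝ) = s := by
          rw [← Real.rpow_add hs, ← Real.rpow_add hs]
          norm_num
        calc s * p = (s ^ (1 / 4 : ℝ) * s ^ (1 / 4 : ℝ) * s ^ (1 / 2 : ℝ)) * p := by rw [this]
          _ = _ := by ring
    _ ≤ _ := by gcongr

/-- In terms of `u = (N/M) p_min`, `U = (N/M) p_max` and the expected number `y` of neighbours in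
other blocks, the assumptions make `y` large. -/
lemma cross_large {K L u U y : ℝ} (hK : 8 ≤ K) (hL : 1 ≤ L) (hu : 0 ≤ u) (huU : u ≤ U)
    (hy : 0 ≤ y) (huy : 0 < u + y) (h1 : K * L ^ 4 * (U + y) ^ 2 ≤ (u + y) ^ 3)
    (h2 : 1 ≤ u → K * u ≤ y ^ 2) :
    K * L ≤ 8 * y ∧ K * (U + y) ≤ 8 * (y * (u + y)) := by
  have hU : 0 ≤ U := hu.trans huU
  have hL4 : L ≤ L ^ 4 := le_self_pow₀ hL (by norm_num)
  have hL41 : 1 ≤ L ^ 4 := hL.trans hL4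
  have h1' : K * (U + y) ^ 2 ≤ (u + y) ^ 3 := by
    refine le_trans ?_ h1
    have : 0 ≤ K * (U + y) ^ 2 := by positivity
    nlinarith
  rcases le_or_gt u y with huy' | hyu
  · have hy0 : 0 < y := by linarith
    have h3 : (u + y) ^ 3 ≤ 8 * y ^ 3 := by
      calc (u + y) ^ 3 ≤ (2 * y) ^ 3 := pow_le_pow_left₀ huy.le (by linarith) 3
        _ = _ := by ring
    -- When `y` dominates, `γmin` is comparable to `y` and the connectivity condition suffices
    -- alone.
    have h4 : K * L ^ 4 * y ^ 2 ≤ 8 * y ^ 3 := by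
      have : K * L ^ 4 * y ^ 2 ≤ K * L ^ 4 * (U + y) ^ 2 := by
        gcongr
        linarith
      linarith
    have h5 : K * L ^ 4 ≤ 8 * y := by
      have : K * L ^ 4 * y ^ 2 ≤ 8 * y * y ^ 2 := by linarith
      exact le_of_mul_le_mul_right this (by positivity)
    refine ⟨(mul_le_mul_of_nonneg_left hL4 (by linarith)).trans h5, ?_⟩
    have h6 : K ≤ 8 * y := by nlinarith
    have h7 : (K * (U + y)) ^ 2 ≤ (8 * y ^ 2) ^ 2 := by
      calc (K * (U + y)) ^ 2 = K * (K * (U + y) ^ 2) := by ring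
        _ ≤ (8 * y) * (8 * y ^ 3) := by
          apply mul_le_mul h6 (h1'.trans h3) (by positivity) (by positivity)
        _ = _ := by ring
    have h8 := abs_le_of_sq_le_sq' h7 (by positivity)
    nlinarith [h8.2, mul_nonneg hu hy]
  · have hu0 : 0 < u := by linarith
    have h3 : (u + y) ^ 3 ≤ 8 * u ^ 3 := by
      calc (u + y) ^ 3 ≤ (2 * u) ^ 3 := pow_le_pow_left₀ huy.le (by linarith) 3
        _ = _ := by ring
    have h4 : K * L ^ 4 * u ^ 2 ≤ 8 * u ^ 3 := by
      have : K * L ^ 4 * u ^ 2 ≤ K * L ^ 4 * (U + y) ^ 2 := by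
        gcongr
        linarith
      linarith
    have h5 : K * L ^ 4 ≤ 8 * u := by
      have : K * L ^ 4 * u ^ 2 ≤ 8 * u * u ^ 2 := by linarith
      exact le_of_mul_le_mul_right this (by positivity)
    -- When `u` dominates, connectivity bounds `u` below, in particular `1 ≤ u`, so the cross-block
    -- hypothesis applies and yields `K u ≤ y²`. Both claims follow after squaring.
    have h6 := h2 (by nlinarith)
    constructor
    · have h7 : (K * L) ^ 2 ≤ (8 * y) ^ 2 := by
        have hL2 : L ^ 2 ≤ L ^ 4 := pow_le_pow_right₀ hL (by norm_num)
        calc (K * L) ^ 2 = K * (K * L ^ 2) := by ring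
          _ ≤ K * (K * L ^ 4) := by gcongr
          _ ≤ K * (8 * u) := by gcongr
          _ = 8 * (K * u) := by ring
          _ ≤ 8 * y ^ 2 := by linarith
          _ ≤ _ := by nlinarith [sq_nonneg y]
      exact (abs_le_of_sq_le_sq' h7 (by positivity)).2
    · have h7 : (K * (U + y)) ^ 2 ≤ (8 * (y * (u + y))) ^ 2 := by
        calc (K * (U + y)) ^ 2 = K * (K * (U + y) ^ 2) := by ring
          _ ≤ K * (8 * u ^ 3) := mul_le_mul_of_nonneg_left (h1'.trans h3) (by linarith)
          _ = 8 * u ^ 2 * (K * u) := by ring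
          _ ≤ 8 * u ^ 2 * y ^ 2 := by gcongr
          _ ≤ 64 * u ^ 2 * y ^ 2 := by gcongr; norm_num
          _ = (8 * (y * u)) ^ 2 := by ring
          _ ≤ _ := by gcongr; linarith
      exact (abs_le_of_sq_le_sq' h7 (by positivity)).2

lemma eventually_cross_large {N M : ℕ → ℕ} (hN : Tendsto N atTop atTop)
    {S : ∀ k, BlockModel (N k) (M k)} (hconn : ConnectivityCondition N M S)
    (hcross : CrossBlockCondition N M S) {K : ℝ} (hK : 8 ≤ K) :
    ∀ᶠ k in atTop, 0 < N k ∧ 0 < M k ∧ 0 < (S k).γmin ∧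
      K * Real.log (N k) ≤ 8 * (S k).crossDegree ∧
      K * (S k).γmax ≤ 8 * ((S k).crossDegree * (S k).γmin) := by
  have hK0 : 0 < K := by linarith
  have hlog : ∀ᶠ k in atTop, 1 ≤ Real.log (N k) :=
    (Real.tendsto_log_atTop.comp (tendsto_natCast_atTop_atTop.comp hN)).eventually_ge_atTop 1
  filter_upwards [hconn.1, hconn.2.eventually (gt_mem_nhds (inv_pos.2 hK0)),
    hcross.def (inv_pos.2 hK0), hlog, hN.eventually_ge_atTop 1] with k hγ hsup hc2 hL hNk
  have hM : 0 < M k := Fin.pos ((S k).block ⟨0, hNk⟩)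
  refine ⟨hNk, hM, hγ, ?_⟩
  have hN' : (0 : ℝ) < N k := by exact_mod_cast hNk
  have hM' : (0 : ℝ) < M k := by exact_mod_cast hM
  set a : ℝ := (N k : ℝ) / M k with ha
  have ha0 : 0 < a := by positivity
  set y := (S k).crossDegree with hy
  set L := Real.log (N k) with hLdef
  have hmin : (S k).γmin = a * (S k).pmin + y := (S k).γmin_eq hM
  have hmax : (S k).γmax = a * (S k).pmax + y := (S k).γmax_eq hM
  have : Nonempty (Fin (M k)) := ⟨⟨0, hM⟩⟩
  have hc1 : K * L ^ 4 * (S k).γmax ^ 2 ≤ (S k).γmin ^ 3 := by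
    -- The supremum is tested at a block of minimal expected degree.
    obtain ⟨m, hm⟩ : ∃ m, (S k).γ m = (S k).γmin := exists_eq_ciInf_of_finite
    have h1 := (le_ciSup (Set.finite_range fun m : Fin (M k) =>
      (M k : ℝ) * Real.log (N k) ^ 4 /
          ((N k : ℝ) * ((S k).p m : ℝ) + (N k : ℝ) * ((M k : ℝ) - 1) * ((S k).q : ℝ)) *
        ((S k).γmax ^ 2 / (S k).γmin ^ 2)).bddAbove m).trans hsup.le
    have h2 : (N k : ℝ) * ((S k).p m : ℝ) + (N k : ℝ) * ((M k : ℝ) - 1) * ((S k).q : ℝ) =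
        M k * (S k).γmin := by
      rw [← hm, BlockModel.γ]
      field_simp
    simp only [h2] at h1
    rw [mul_div_mul_left _ _ hM'.ne', div_mul_div_comm, inv_eq_one_div,
      div_le_div_iff₀ (by positivity) hK0] at h1
    linarith
  rw [hmin, hmax] at hc1 ⊢
  rw [hmin] at hγ
  have hp0 := (S k).pmin_nonneg
  refine cross_large hK hL (by positivity)
    (mul_le_mul_of_nonneg_left ((S k).pmin_le_pmax hM) ha0.le) ((S k).crossDegree_nonneg hM) hγ
    hc1 fun hu => ?_
  -- The case `1 ≤ u` means exactly `M/N ≤ p_min`, which is what allows the mixed power to be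
  -- bounded below by `(M/N) p_min`. Rescaling by `(N/M)²` gives `K u ≤ y²`.
  have hsp : 1 / a ≤ (S k).pmin := by
    rw [div_le_iff₀ ha0]
    linarith
  have hmix := mul_le_mixed_rpow (one_div_pos.2 ha0) hL hsp ((S k).pmin_le_pmax hM)
  have hs : 1 / a * L = (M k : ℝ) * Real.log (N k) / (N k : ℝ) := by
    rw [ha, hLdef]
    field_simp
  rw [hs] at hmix
  have h3 := hmix.trans ((le_abs_self _).trans hc2)
  rw [Real.norm_eq_abs, abs_of_nonneg (sq_nonneg _), inv_mul_eq_div, le_div_iff₀ hK0] at h3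
  have h4 : y ^ 2 = a ^ 2 * (((M k : ℝ) - 1) * ((S k).q : ℝ)) ^ 2 := by
    rw [hy, BlockModel.crossDegree]
    ring
  rw [h4]
  calc K * (a * (S k).pmin) = a ^ 2 * (1 / a * (S k).pmin * K) := by field_simp
    _ ≤ _ := mul_le_mul_of_nonneg_left h3 (sq_nonneg a)

lemma natCast_mul_exp_le {n : ℕ} (hn : 0 < n) {x : ℝ} (hx : 2 * Real.log n ≤ x) :
    n * Real.exp (-x) ≤ 1 / n := by
  have hn' : (0 : ℝ) < n := by exact_mod_cast hn
  calc (n : ℝ) * Real.exp (-x) = Real.exp (Real.log n + -x) := by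
        rw [Real.exp_add, Real.exp_log hn']
    _ ≤ Real.exp (-Real.log n) := Real.exp_le_exp.2 (by linarith)
    _ = 1 / n := by rw [Real.exp_neg, Real.exp_log hn', one_div]

end SBM

end

/-! ### Conclusion: choice of constants and passage to the limit -/

theorem theorem1p2 (N M : ℕ → ℕ) (hN : Tendsto N atTop atTop)
    (hM : (fun k => (M k : ℝ)) =o[atTop] fun k => (N k : ℝ))
    (S : ∀ k, SBM.BlockModel (N k) (M k))
    (hconn : SBM.ConnectivityCondition N M S)
    (hcross : SBM.CrossBlockCondition N M S) :
    ∀ ε : ℝ, 0 < ε →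
      Tendsto
        (fun k => (S k).graphLaw {G | ∀ w : Fin (N k),
          SBM.averageHittingTime G w ≠ ∞ ∧
          |(SBM.averageHittingTime G w).toReal /
              ((N k : ℝ) / (M k : ℝ) * ((∑ m, (S k).γ m) / (S k).γ ((S k).block w))) - 1| ≤ ε})
        atTop (𝓝 1) := by
  intro ε hε
  obtain ⟨δ, hδ0, hδ1, hδε⟩ : ∃ δ : ℝ, 0 < δ ∧ δ ≤ 1 / 2 ∧ 8 * δ ≤ ε :=
    ⟨min (1 / 2) (ε / 8), by positivity, min_le_left _ _, by
      linarith [min_le_right (1 / 2 : ℝ) (ε / 8)]⟩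
  -- The entry `266` makes the deterministic error at most `δ`. The entry `64 + 8/δ²` makes `y/32`
  -- and `γmin δ²/4` at least `2 log N`, so that each union bound over vertices costs at most `1/N`.
  set K : ℝ := 8 * max 266 (64 + 8 / δ ^ 2) / δ with hK
  have hδ2 : 0 < 8 / δ ^ 2 := by positivity
  have hKδ : 8 * max 266 (64 + 8 / δ ^ 2) = K * δ := by
    rw [hK]
    field_simp
  have hmax1 : (266 : ℝ) ≤ max 266 (64 + 8 / δ ^ 2) := le_max_left _ _
  have hmax2 : 64 + 8 / δ ^ 2 ≤ max 266 (64 + 8 / δ ^ 2) := le_max_right _ _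
  have hK0 : 0 < K := by positivity
  have hKle : K * δ ≤ K := by nlinarith
  have hev := SBM.eventually_cross_large hN hconn hcross (K := K) (by linarith)
  have hlim0 : Tendsto (fun k => 1 / (N k : ℝ)) atTop (𝓝 0) :=
    tendsto_one_div_atTop_nhds_zero_nat.comp hN
  have hlim : Tendsto (fun k => 1 - (2 * (1 / (N k : ℝ)) + 1 / (N k : ℝ) +
      (Real.exp (1 / (N k : ℝ)) - 1))) atTop (𝓝 1) := by
    have h1 := (Real.continuous_exp.tendsto 0).comp hlim0
    rw [Real.exp_zero] at h1
    have h2 := tendsto_const_nhds (x := (1 : ℝ)).sub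
      (((hlim0.const_mul 2).add hlim0).add (h1.sub_const 1))
    simpa using h2
  rw [← ENNReal.tendsto_toReal_iff (fun _ => measure_ne_top _ _) ENNReal.one_ne_top,
    ENNReal.toReal_one]
  refine tendsto_of_tendsto_of_tendsto_of_le_of_le' hlim tendsto_const_nhds ?_
    (Eventually.of_forall fun k => measureReal_le_one)
  filter_upwards [hev] with k ⟨hNk, hMk, hγ, hL, hR⟩
  have hlog0 : 0 ≤ Real.log (N k) := Real.log_natCast_nonneg _
  have hL' : 2 * Real.log (N k) * (32 + 4 / δ ^ 2) ≤ (S k).crossDegree := by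
    have h1 : 8 * (64 + 8 / δ ^ 2) * Real.log (N k) ≤ K * Real.log (N k) :=
      mul_le_mul_of_nonneg_right (by linarith) hlog0
    have h2 : 8 * (64 + 8 / δ ^ 2) * Real.log (N k) =
        8 * (2 * Real.log (N k) * (32 + 4 / δ ^ 2)) := by ring
    linarith
  have hγmax : 0 < (S k).γmax := by
    have m : Fin (M k) := ⟨0, hMk⟩
    exact hγ.trans_le (((S k).γmin_le m).trans ((S k).le_γmax m))
  have hy : 0 < (S k).crossDegree := by
    have : 0 < (S k).crossDegree * (S k).γmin := by
      have := mul_pos hK0 hγmax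
      linarith
    exact pos_of_mul_pos_left this hγ.le
  have hyγ : (S k).crossDegree ≤ (S k).γmin := by
    rw [(S k).γmin_eq hMk]
    have : 0 ≤ (N k : ℝ) / M k * (S k).pmin := mul_nonneg (by positivity) (S k).pmin_nonneg
    linarith
  have hδlog : 0 ≤ Real.log (N k) * (4 / δ ^ 2) := by positivity
  have hbad := (S k).measure_not_isTypical_le hMk hδ0 (by linarith)
  have e1 : (N k : ℝ) * Real.exp (-(S k).γmin * δ ^ 2 / 4) ≤ 1 / (N k : ℝ) := by
    rw [show -(S k).γmin * δ ^ 2 / 4 = -((S k).γmin * δ ^ 2 / 4) by ring]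
    refine SBM.natCast_mul_exp_le hNk ?_
    have h1 : 2 * Real.log (N k) * (4 / δ ^ 2) ≤ (S k).γmin := by linarith
    have h2 := mul_le_mul_of_nonneg_right h1 (show 0 ≤ δ ^ 2 / 4 by positivity)
    have h3 : 2 * Real.log (N k) * (4 / δ ^ 2) * (δ ^ 2 / 4) = 2 * Real.log (N k) := by
      field_simp
    linarith
  have e2 : (N k : ℝ) * Real.exp (-(S k).crossDegree / 4) ≤ 1 / (N k : ℝ) := by
    rw [neg_div]
    exact SBM.natCast_mul_exp_le hNk (by linarith)
  have e3 : (N k : ℝ) * Real.exp (-(S k).crossDegree / 32) ≤ 1 / (N k : ℝ) := by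
    rw [neg_div]
    exact SBM.natCast_mul_exp_le hNk (by linarith)
  have e4 := Real.exp_le_exp.2 e3
  have hcompl := probReal_compl_eq_one_sub (μ := (S k).graphLaw)
    (Set.toFinite {G | ¬ (S k).IsTypical δ G}).measurableSet
  have hsub : {G | ¬ (S k).IsTypical δ G}ᶜ ⊆ {G | ∀ w : Fin (N k),
      SBM.averageHittingTime G w ≠ ∞ ∧
      |(SBM.averageHittingTime G w).toReal /
        ((N k : ℝ) / (M k : ℝ) * ((∑ m, (S k).γ m) / (S k).γ ((S k).block w))) - 1| ≤ ε} := by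
    intro G hG w
    have hG' : (S k).IsTypical δ G := not_not.1 hG
    have hR' : 266 * (S k).γmax ≤ δ * ((S k).crossDegree * (S k).γmin) := by
      have h1 := mul_le_mul_of_nonneg_left hR hδ0.le
      have h2 : 8 * 266 * (S k).γmax ≤ K * δ * (S k).γmax :=
        mul_le_mul_of_nonneg_right (by linarith) hγmax.le
      linarith
    obtain ⟨h1, h2⟩ := hG'.abs_averageHittingTime_div_sub_one_le hNk hMk hy hγ hδ0 hδ1 hR' w
    exact ⟨h1, h2.trans hδε⟩
  have hmono := measureReal_mono (μ := (S k).graphLaw) hsub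
  rw [hcompl] at hmono
  refine le_trans ?_ hmono
  linarith
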